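/- Let $f\colon X\to Y$ be a continuous map of simply connected topological spaces such that $\dim H_*(X;\mathbb Q)=\sum_i\dim H_i(X;\mathbb Q)<\infty$, and suppose that $f$ is rationally elliptic with respect to kernel, that is, $\sum_i\dim\operatorname{Ker}H_i(f;\mathbb Q)<\infty$ and $\sum_{i\ge 2}\dim\operatorname{Ker}(\pi_i(f)\otimes\mathbb Q)<\infty$. For such a map define the polynomials $$P_f(t)=1+\sum_{i\ge 2}t^i\dim\operatorname{Ker}\bigl(H_i(f;\mathbb Q)\colon H_i(X;\mathbb Q)\to H_i(Y;\mathbb Q)\bigr),$$ $$P^{\pi}_f(t)=\sum_{i\ge 2}t^i\dim\operatorname{Ker}\bigl(\pi_i(f)\otimes\mathbb Q\colon \pi_i(X)\otimes\mathbb Q\to \pi_i(Y)\otimes\mathbb Q\bigr).$$ For an integer $n\ge 0$ let $f^n\colon X^n\to Y^n$ be the map $(x_1,\dots,x_n)\mapsto(f(x_1),\dots,f(x_n))$ (for $n=0$, the map between one-point spaces). Then $f^n$ is again rationally elliptic with respect to kernel (so that $P_{f^n}$ and $P^{\pi}_{f^n}$ are defined), and 1. $P^{\pi}_{f^n}(t)=n\,P^{\pi}_f(t)$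 for all $t\in\mathbb R$; 2. $\bigl(P_f(t)\bigr)^n\le P_{f^n}(t)$ for all real $t\ge 0$. Here homotopy groups may be taken at arbitrary base points of $X$ and of $X^n$ (and at their images in $Y$ and $Y^n$). -/

import Mathlib

open CategoryTheory Topology TensorProduct

universe u

noncomputable section

namespace MapPoincare

variable {X Y : Type u} [TopologicalSpace X] [TopologicalSpace Y]

/-! ### Rational singular homology -/

/-- `H_i(X; ℚ)`, the `i`-th singular homology of `X` with rational coefficients. -/
abbrev RatHomology (i : ℕ) (X : Type u) [TopologicalSpace X] : ModuleCat.{u} ℚ :=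
  ((AlgebraicTopology.singularHomologyFunctor (ModuleCat.{u} ℚ) i).obj
    (ModuleCat.of ℚ (ULift.{u} ℚ))).obj (TopCat.of X)

/-- `H_i(f; ℚ) : H_i(X; ℚ) → H_i(Y; ℚ)`. -/
def ratHomologyMap (i : ℕ) (f : C(X, Y)) : RatHomology i X →ₗ[ℚ] RatHomology i Y :=
  (((AlgebraicTopology.singularHomologyFunctor (ModuleCat.{u} ℚ) i).obj
    (ModuleCat.of ℚ (ULift.{u} ℚ))).map (TopCat.ofHom f)).hom

/-! ### Rational homotopy groups -/

/-- The image `f ∘ p` of an `N`-dimensional loop `p` at `x`. -/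
def genLoopMap (N : Type) (f : C(X, Y)) (x : X) (p : GenLoop N X x) : GenLoop N Y (f x) :=
  ⟨f.comp p.1, fun y hy => congrArg f (p.2 y hy)⟩

/-- The map of homotopy groups `[p] ↦ [f ∘ p]`, as a map of sets. -/
def homotopyGroupMap (N : Type) (f : C(X, Y)) (x : X) :
    HomotopyGroup N X x → HomotopyGroup N Y (f x) :=
  Quotient.map (genLoopMap N f x) fun _ _ h => ContinuousMap.HomotopicRel.comp_continuousMap h f

/-- `π_{k+2}(f) : π_{k+2}(X, x) → π_{k+2}(Y, f x)`. -/
def piMap (k : ℕ) (f : C(X, Y)) (x : X) : (π_ (k + 2) X x) →* (π_ (k + 2) Y (f x)) :=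
  MonoidHom.mk' (homotopyGroupMap (Fin (k + 2)) f x) <| by
    rintro ⟨p⟩ ⟨q⟩
    have h₁ := HomotopyGroup.mul_spec (i := (0 : Fin (k + 2))) (p := p) (q := q)
    have h₂ := HomotopyGroup.mul_spec (i := (0 : Fin (k + 2)))
      (p := genLoopMap _ f x p) (q := genLoopMap _ f x q)
    refine (congrArg (homotopyGroupMap (Fin (k + 2)) f x) h₁).trans (Eq.trans ?_ h₂.symm)
    refine congrArg (Quotient.mk _) (GenLoop.ext _ _ fun t => ?_)
    exact apply_ite f _ _ _

/-- `π_{k+2}(X, x) ⊗ ℚ`, as a rational vector space. -/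
abbrev RatHomotopy (k : ℕ) (X : Type u) [TopologicalSpace X] (x : X) : Type u :=
  ℚ ⊗[ℤ] Additive (π_ (k + 2) X x)

/-- `π_{k+2}(f) ⊗ ℚ : π_{k+2}(X, x) ⊗ ℚ → π_{k+2}(Y, f x) ⊗ ℚ`. -/
def ratHomotopyMap (k : ℕ) (f : C(X, Y)) (x : X) :
    RatHomotopy k X x →ₗ[ℚ] RatHomotopy k Y (f x) :=
  (MonoidHom.toAdditive (piMap k f x)).toIntLinearMap.baseChange ℚ

/-! ### Finiteness conditions -/

/-- `∑ i, dim (V i) < ∞`: every `V i` is finite dimensional and almost all of them vanish. -/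
def FiniteTotalDim (V : ℕ → Type u) [∀ i, AddCommGroup (V i)] [∀ i, Module ℚ (V i)] : Prop :=
  (∀ i, FiniteDimensional ℚ (V i)) ∧ {i | Nontrivial (V i)}.Finite

/-- The homology rank of `X` is finite: `dim H_*(X; ℚ) < ∞`. -/
def FiniteHomologyRank (X : Type u) [TopologicalSpace X] : Prop :=
  FiniteTotalDim fun i => RatHomology i X

/-- The map `f` of simply connected spaces is rationally elliptic with respect to kernel:
`dim Ker H_*(f; ℚ) < ∞` and `dim Ker (π_*(f) ⊗ ℚ) < ∞`. The homotopy groups are taken at `x`, and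
start in degree two because the fundamental group of a simply connected space is trivial. -/
def IsRationallyEllipticKer (f : C(X, Y)) (x : X) : Prop :=
  FiniteTotalDim (fun i => LinearMap.ker (ratHomologyMap i f)) ∧
    FiniteTotalDim (fun k => LinearMap.ker (ratHomotopyMap k f x))

/-! ### Poincaré polynomials of a map -/

/-- `P_f = 1 + ∑_{i ≥ 2} dim Ker H_i(f; ℚ) t^i`; the sum is finite when `f` is rationally elliptic
with respect to kernel. -/
def homologicalPoincare (f : C(X, Y)) : Polynomial ℕ :=
  1 + ∑ᶠ k : ℕ, Polynomial.monomial (k + 2)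
    (Module.finrank ℚ (LinearMap.ker (ratHomologyMap (k + 2) f)))

/-- `P^π_f = ∑_{i ≥ 2} dim Ker (π_i(f) ⊗ ℚ) t^i`, with homotopy groups taken at `x`; the sum is
finite when `f` is rationally elliptic with respect to kernel. -/
def homotopicalPoincare (f : C(X, Y)) (x : X) : Polynomial ℕ :=
  ∑ᶠ k : ℕ, Polynomial.monomial (k + 2)
    (Module.finrank ℚ (LinearMap.ker (ratHomotopyMap k f x)))

/-- `f^n : X^n → Y^n`, `(x_1, …, x_n) ↦ (f x_1, …, f x_n)`. -/
def power (n : ℕ) (f : C(X, Y)) : C(Fin n → X, Fin n → Y) where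
  toFun z i := f (z i)
  continuous_toFun := by fun_prop

end MapPoincare

end

/-! Homotopy. A loop in a power is a tuple of loops, and tensoring with `ℚ` commutes with finite
products, so the kernel for `f^n` is the product of the kernels for `f` at the `n` coordinates of
the base point. These coordinates may differ from each other and from `x`; each is moved to `x`
along a path, transport being a group isomorphism compatible with `f` (`rank_ker_ratHomotopyMap`).

Homology. For `f : X → X'` and `g : Y → Y'`, the Künneth theorem shows that the kernel of `H_k(f ×
g)` contains, for each `p + q = k`, both `ker H_p(f) ⊗ H_q(Y)` and `H_p(X) ⊗ ker H_q(g)`. The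
constant coefficient 1 of a Poincaré polynomial is the dimension of `H_0` of a path connected space,
so each product of a coefficient of `P_f` with one of `P_g` is at most one of these two dimensions,
except in total degrees 0 and 1, which are fixed by convention. Hence `P_f P_g ≤ P_{f × g}`
coefficientwise, and induction on `n` gives the inequality for `t ≥ 0`.

The part of Künneth that is needed is proved by dimension counting, without shuffle maps. Singular
chains on a product are the levelwise tensor product `A ⊗ B` of simplicial modules, and `A` is
dismantled one degree at a time. In homology `A ⊗ B` splits into a constant part `π₀ A ⊗ B`, where
the answer is `π₀ A ⊗ H_k(B)`, and a reduced part. Décalage provides a path module over the reduced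
part, contractible and with fibre `loops A`, so that `H_{k+1}(reduced A ⊗ B) ≅ H_k(loops A ⊗ B)`.
This recursion (`rank_ker_tensor_succ`) yields the lower bound `sum_max_le_rank_ker_tensor` for
kernels and the upper bound `rank_homology_tensor_le`, which makes the homology of `X^n` finite
dimensional. -/

noncomputable section

section

open Opposite Simplicial

/-- Simplicial rational vector spaces. -/
abbrev SimplicialModule : Type (u + 1) := SimplicialObject (ModuleCat.{u} ℚ)

namespace SimplicialModule

variable {A A' A'' B B' B'' C C' K K' : SimplicialModule.{u}}

/-! ### Homology -/

/-- The homology of the alternating face map complex of a simplicial module. -/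
def homologyFunctor (k : ℕ) : SimplicialModule.{u} ⥤ ModuleCat.{u} ℚ :=
  AlgebraicTopology.alternatingFaceMapComplex _ ⋙ HomologicalComplex.homologyFunctor _ _ k

instance (k : ℕ) : (homologyFunctor.{u} k).Additive := by
  unfold homologyFunctor; infer_instance

/-- The homology of a simplicial module. -/
abbrev homology (k : ℕ) (A : SimplicialModule.{u}) : ModuleCat.{u} ℚ := (homologyFunctor k).obj A

/-- The map induced on homology. -/
def homologyMap (k : ℕ) (f : A ⟶ B) : homology k A →ₗ[ℚ] homology k B :=
  ((homologyFunctor k).map f).hom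

lemma homologyMap_id (k : ℕ) (A : SimplicialModule.{u}) :
    homologyMap k (𝟙 A) = LinearMap.id := by
  simp [homologyMap]

lemma homologyMap_comp (k : ℕ) (f : A ⟶ B) (g : B ⟶ C) :
    homologyMap k (f ≫ g) = homologyMap k g ∘ₗ homologyMap k f := by
  simp [homologyMap]

lemma homologyMap_comp_apply (k : ℕ) (f : A ⟶ B) (g : B ⟶ C) (x : homology k A) :
    homologyMap k (f ≫ g) x = homologyMap k g (homologyMap k f x) := by
  rw [homologyMap_comp]; rfl

lemma homologyMap_add (k : ℕ) (f g : A ⟶ B) :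
    homologyMap k (f + g) = homologyMap k f + homologyMap k g := by
  simp [homologyMap, Functor.map_add]

lemma homologyMap_zero (k : ℕ) : homologyMap k (0 : A ⟶ B) = 0 := by
  simp [homologyMap]

lemma homologyMap_sub (k : ℕ) (f g : A ⟶ B) :
    homologyMap k (f - g) = homologyMap k f - homologyMap k g := by
  simp [homologyMap, Functor.map_sub]

lemma homologyMap_sum (k : ℕ) {ι : Type*} (s : Finset ι) (f : ι → (A ⟶ B)) :
    homologyMap k (∑ i ∈ s, f i) = ∑ i ∈ s, homologyMap k (f i) := by
  classical
  induction s using Finset.induction_on with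
  | empty => simp [homologyMap_zero]
  | insert a s ha ih => rw [Finset.sum_insert ha, Finset.sum_insert ha, homologyMap_add, ih]

lemma homologyMap_eq_of_homotopy (k : ℕ) {f g : A ⟶ B} (H : SimplicialObject.Homotopy f g) :
    homologyMap k f = homologyMap k g :=
  congrArg ModuleCat.Hom.hom (H.map_homology_eq k)

/-- An isomorphism of simplicial modules induces an isomorphism on homology. -/
def homologyEquiv (k : ℕ) (e : A ≅ B) : homology k A ≃ₗ[ℚ] homology k B :=
  ((homologyFunctor k).mapIso e).toLinearEquiv

/-! ### Levelwise tensor products -/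

/-- The levelwise tensor product. -/
def tensor (A B : SimplicialModule.{u}) : SimplicialModule.{u} where
  obj n := ModuleCat.of ℚ (A.obj n ⊗[ℚ] B.obj n)
  map f := ModuleCat.ofHom (TensorProduct.map (A.map f).hom (B.map f).hom)
  map_id n := by ext : 1; simp
  map_comp f g := by ext : 1; simp [TensorProduct.map_comp]

/-- The levelwise tensor product of morphisms. -/
def tensorMap (f : A ⟶ A') (g : B ⟶ B') : tensor A B ⟶ tensor A' B' where
  app n := ModuleCat.ofHom (TensorProduct.map (f.app n).hom (g.app n).hom)
  naturality m n θ := by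
    ext : 1
    simp only [tensor, ModuleCat.hom_comp, ModuleCat.hom_ofHom, ← TensorProduct.map_comp]
    congr 1
    · exact congrArg ModuleCat.Hom.hom (f.naturality θ)
    · exact congrArg ModuleCat.Hom.hom (g.naturality θ)

lemma tensor_hom_ext {f g : tensor A B ⟶ C}
    (h : ∀ n (a : A.obj n) (b : B.obj n),
      (f.app n).hom (a ⊗ₜ[ℚ] b) = (g.app n).hom (a ⊗ₜ[ℚ] b)) : f = g :=
  NatTrans.ext <| funext fun n => ModuleCat.hom_ext <| TensorProduct.ext' (h n)

lemma tensorMap_id : tensorMap (𝟙 A) (𝟙 B) = 𝟙 (tensor A B) :=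
  tensor_hom_ext fun _ _ _ => rfl

lemma tensorMap_comp (f : A ⟶ A') (f' : A' ⟶ A'') (g : B ⟶ B') (g' : B' ⟶ B'') :
    tensorMap (f ≫ f') (g ≫ g') = tensorMap f g ≫ tensorMap f' g' :=
  tensor_hom_ext fun _ _ _ => rfl

lemma tensorMap_add_left (f f' : A ⟶ A') (g : B ⟶ B') :
    tensorMap (f + f') g = tensorMap f g + tensorMap f' g :=
  tensor_hom_ext fun _ _ _ => TensorProduct.add_tmul _ _ _

lemma tensorMap_zero_left (g : B ⟶ B') : tensorMap (0 : A ⟶ A') g = 0 :=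
  tensor_hom_ext fun _ _ _ => TensorProduct.zero_tmul _ _

lemma tensorMap_sub_left (f f' : A ⟶ A') (g : B ⟶ B') :
    tensorMap (f - f') g = tensorMap f g - tensorMap f' g := by
  rw [eq_sub_iff_add_eq, ← tensorMap_add_left, sub_add_cancel]

/-- The tensor product of simplicial homotopies. -/
def tensorHomotopy {f f' : A ⟶ A'} {g g' : B ⟶ B'} (H : SimplicialObject.Homotopy f f')
    (H' : SimplicialObject.Homotopy g g') :
    SimplicialObject.Homotopy (tensorMap f g) (tensorMap f' g') where
  -- Each identity of a simplicial homotopy equates composites of single operators, with no sums, so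
  -- it survives the levelwise tensor product.
  h i := ModuleCat.ofHom (TensorProduct.map (H.h i).hom (H'.h i).hom)
  h_zero_comp_δ_zero n := by
    ext : 1
    refine (TensorProduct.map_comp _ _ _ _).symm.trans ?_
    exact congrArg₂ TensorProduct.map (congrArg ModuleCat.Hom.hom (H.h_zero_comp_δ_zero n))
      (congrArg ModuleCat.Hom.hom (H'.h_zero_comp_δ_zero n))
  h_last_comp_δ_last n := by
    ext : 1
    refine (TensorProduct.map_comp _ _ _ _).symm.trans ?_
    exact congrArg₂ TensorProduct.map (congrArg ModuleCat.Hom.hom (H.h_last_comp_δ_last n))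
      (congrArg ModuleCat.Hom.hom (H'.h_last_comp_δ_last n))
  h_succ_comp_δ_castSucc_of_lt i j hij := by
    ext : 1
    refine (TensorProduct.map_comp _ _ _ _).symm.trans (Eq.trans ?_ (TensorProduct.map_comp _ _ _ _))
    exact congrArg₂ TensorProduct.map
      (congrArg ModuleCat.Hom.hom (H.h_succ_comp_δ_castSucc_of_lt i j hij))
      (congrArg ModuleCat.Hom.hom (H'.h_succ_comp_δ_castSucc_of_lt i j hij))
  h_succ_comp_δ_castSucc_succ j := by
    ext : 1
    refine (TensorProduct.map_comp _ _ _ _).symm.trans (Eq.trans ?_ (TensorProduct.map_comp _ _ _ _))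
    exact congrArg₂ TensorProduct.map
      (congrArg ModuleCat.Hom.hom (H.h_succ_comp_δ_castSucc_succ j))
      (congrArg ModuleCat.Hom.hom (H'.h_succ_comp_δ_castSucc_succ j))
  h_castSucc_comp_δ_succ_of_lt i j hij := by
    ext : 1
    refine (TensorProduct.map_comp _ _ _ _).symm.trans (Eq.trans ?_ (TensorProduct.map_comp _ _ _ _))
    exact congrArg₂ TensorProduct.map
      (congrArg ModuleCat.Hom.hom (H.h_castSucc_comp_δ_succ_of_lt i j hij))
      (congrArg ModuleCat.Hom.hom (H'.h_castSucc_comp_δ_succ_of_lt i j hij))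
  h_comp_σ_castSucc_of_le i j hij := by
    ext : 1
    refine (TensorProduct.map_comp _ _ _ _).symm.trans (Eq.trans ?_ (TensorProduct.map_comp _ _ _ _))
    exact congrArg₂ TensorProduct.map
      (congrArg ModuleCat.Hom.hom (H.h_comp_σ_castSucc_of_le i j hij))
      (congrArg ModuleCat.Hom.hom (H'.h_comp_σ_castSucc_of_le i j hij))
  h_comp_σ_succ_of_lt i j hij := by
    ext : 1
    refine (TensorProduct.map_comp _ _ _ _).symm.trans (Eq.trans ?_ (TensorProduct.map_comp _ _ _ _))
    exact congrArg₂ TensorProduct.map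
      (congrArg ModuleCat.Hom.hom (H.h_comp_σ_succ_of_lt i j hij))
      (congrArg ModuleCat.Hom.hom (H'.h_comp_σ_succ_of_lt i j hij))

/-! ### Kernels and the long exact homology sequence -/

/-- The kernel of a morphism of simplicial modules. -/
def ker (f : A ⟶ B) : SimplicialModule.{u} where
  obj n := ModuleCat.of ℚ (LinearMap.ker (f.app n).hom)
  map {m n} θ := ModuleCat.ofHom ((A.map θ).hom.restrict fun x hx => by
    have := congrArg (fun φ => φ.hom x) (f.naturality θ)
    simp only [ModuleCat.hom_comp, LinearMap.comp_apply] at this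
    rw [LinearMap.mem_ker] at hx ⊢
    rw [this, hx, map_zero])
  map_id n := by ext x; exact congrArg (fun φ => φ.hom x.1) (A.map_id n)
  map_comp θ η := by ext x; exact congrArg (fun φ => φ.hom x.1) (A.map_comp θ η)

/-- The inclusion of the kernel. -/
def kerι (f : A ⟶ B) : ker f ⟶ A where
  app n := ModuleCat.ofHom (LinearMap.ker (f.app n).hom).subtype

@[simp]
lemma kerι_comp (f : A ⟶ B) : kerι f ≫ f = 0 := by
  ext n x
  exact x.2

lemma kerι_comp_assoc (f : A ⟶ B) (h : B ⟶ C) : kerι f ≫ f ≫ h = 0 ≫ h := by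
  rw [← Category.assoc, kerι_comp]

instance (f : A ⟶ B) : Mono (kerι f) where
  right_cancellation g h e := by
    ext n x
    exact Subtype.ext (congrArg (fun φ => (φ.app n).hom x) e)

/-- A morphism killed by `f` factors through the kernel of `f`. -/
def kerLift (f : A ⟶ B) (g : C ⟶ A) (w : g ≫ f = 0) : C ⟶ ker f where
  app n := ModuleCat.ofHom ((g.app n).hom.codRestrict _ fun x =>
    congrArg (fun φ : C ⟶ B => (φ.app n).hom x) w)
  naturality m n θ := by
    ext x
    exact Subtype.ext (congrArg (fun φ => φ.hom x) (g.naturality θ))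

@[simp]
lemma kerLift_ι (f : A ⟶ B) (g : C ⟶ A) (w : g ≫ f = 0) : kerLift f g w ≫ kerι f = g := rfl

/-- The map between kernels induced by a commutative square. -/
def kerMap {f : A ⟶ B} {f' : A' ⟶ B'} (a : A ⟶ A') (b : B ⟶ B') (w : f ≫ b = a ≫ f') :
    ker f ⟶ ker f' :=
  kerLift f' (kerι f ≫ a) (by rw [Category.assoc, ← w, kerι_comp_assoc, Limits.zero_comp])

/-- A levelwise short exact sequence `0 → K → A → C → 0` of simplicial modules. -/
structure LevelExact (i : K ⟶ A) (p : A ⟶ C) : Prop where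
  inj : ∀ n, Function.Injective (i.app n).hom
  exact : ∀ n, Function.Exact (i.app n).hom (p.app n).hom
  surj : ∀ n, Function.Surjective (p.app n).hom

lemma levelExact_kerι {f : A ⟶ B} (hf : ∀ n, Function.Surjective (f.app n).hom) :
    LevelExact (kerι f) f where
  inj n := Subtype.val_injective
  exact n x := ⟨fun hx => ⟨⟨x, hx⟩, rfl⟩, by rintro ⟨y, rfl⟩; exact y.2⟩
  surj := hf

namespace LevelExact

variable {i : K ⟶ A} {p : A ⟶ C} {i' : K' ⟶ A'} {p' : A' ⟶ C'}

/-- Every rational vector space is flat, so tensoring each level with `B` keeps exactness. -/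
lemma tensor (h : LevelExact i p) (B : SimplicialModule.{u}) :
    LevelExact (tensorMap i (𝟙 B)) (tensorMap p (𝟙 B)) where
  inj n := Module.Flat.rTensor_preserves_injective_linearMap (M := B.obj n) _ (h.inj n)
  exact n := rTensor_exact (B.obj n) (h.exact n) (h.surj n)
  surj n := LinearMap.rTensor_surjective (B.obj n) (h.surj n)

lemma comp_eq_zero (h : LevelExact i p) : i ≫ p = 0 := by
  ext n x
  exact (h.exact n).apply_apply_eq_zero x

/-- The short complex of chain complexes underlying a levelwise short exact sequence. -/
abbrev shortComplex (h : LevelExact i p) : ShortComplex (ChainComplex (ModuleCat.{u} ℚ) ℕ) :=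
  ShortComplex.mk ((AlgebraicTopology.alternatingFaceMapComplex _).map i)
    ((AlgebraicTopology.alternatingFaceMapComplex _).map p)
    (by rw [← Functor.map_comp, h.comp_eq_zero, Functor.map_zero])

lemma shortExact (h : LevelExact i p) : h.shortComplex.ShortExact := by
  refine HomologicalComplex.shortExact_of_degreewise_shortExact _ fun n => ?_
  have : Mono (h.shortComplex.map (HomologicalComplex.eval _ _ n)).f :=
    (ModuleCat.mono_iff_injective _).2 (h.inj (op ⦋n⦌))
  have : Epi (h.shortComplex.map (HomologicalComplex.eval _ _ n)).g :=
    (ModuleCat.epi_iff_surjective _).2 (h.surj (op ⦋n⦌))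
  refine ShortComplex.ShortExact.mk ?_
  exact (ShortComplex.ShortExact.moduleCat_exact_iff_function_exact _).2 (h.exact (op ⦋n⦌))

/-- The connecting map of the long exact homology sequence. -/
def δ (h : LevelExact i p) (k : ℕ) : homology (k + 1) C →ₗ[ℚ] homology k K :=
  (h.shortExact.δ (k + 1) k (by simp)).hom

lemma exact₁ (h : LevelExact i p) (k : ℕ) : Function.Exact (h.δ k) (homologyMap k i) :=
  (ShortComplex.ShortExact.moduleCat_exact_iff_function_exact _).1
    (h.shortExact.homology_exact₁ (k + 1) k (by simp))

lemma exact₂ (h : LevelExact i p) (k : ℕ) : Function.Exact (homologyMap k i) (homologyMap k p) :=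
  (ShortComplex.ShortExact.moduleCat_exact_iff_function_exact _).1
    (h.shortExact.homology_exact₂ k)

lemma exact₃ (h : LevelExact i p) (k : ℕ) : Function.Exact (homologyMap (k + 1) p) (h.δ k) :=
  (ShortComplex.ShortExact.moduleCat_exact_iff_function_exact _).1
    (h.shortExact.homology_exact₃ (k + 1) k (by simp))

lemma surjective_zero (h : LevelExact i p) : Function.Surjective (homologyMap 0 p) := by
  have := h.shortExact.epi_g
  exact (ModuleCat.epi_iff_surjective _).1
    (HomologicalComplex.epi_homologyMap_of_epi_of_not_rel h.shortComplex.g 0 (by simp))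

lemma δ_naturality (h : LevelExact i p) (h' : LevelExact i' p') (φ : K ⟶ K') (α : A ⟶ A')
    (γ : C ⟶ C') (w : i ≫ α = φ ≫ i') (w' : p ≫ γ = α ≫ p') (k : ℕ)
    (x : homology (k + 1) C) :
    homologyMap k φ (h.δ k x) = h'.δ k (homologyMap (k + 1) γ x) := by
  let Φ : h.shortComplex ⟶ h'.shortComplex :=
    { τ₁ := (AlgebraicTopology.alternatingFaceMapComplex _).map φ
      τ₂ := (AlgebraicTopology.alternatingFaceMapComplex _).map α
      τ₃ := (AlgebraicTopology.alternatingFaceMapComplex _).map γ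
      comm₁₂ := by dsimp only; rw [← Functor.map_comp, ← Functor.map_comp, w]
      comm₂₃ := by dsimp only; rw [← Functor.map_comp, ← Functor.map_comp, w'] }
  exact congrArg (fun ψ => ψ.hom x) (HomologicalComplex.HomologySequence.δ_naturality Φ
    h.shortExact h'.shortExact (k + 1) k (by simp))

end LevelExact

end SimplicialModule

/-! ### The shift functor behind décalage -/

namespace SimplexCategory

/-- The functor adjoining a new initial vertex, `⦋n⦌ ↦ ⦋n + 1⦌`. -/
def shift : SimplexCategory ⥤ SimplexCategory where
  obj n := ⦋n.len + 1⦌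
  map {m n} f := Hom.mk
    { toFun := Fin.cases 0 fun i => (f.toOrderHom i).succ
      monotone' := fun i j hij => by
        induction i using Fin.cases with
        | zero => exact Fin.zero_le _
        | succ i =>
          induction j using Fin.cases with
          | zero => exact absurd hij (by simp)
          | succ j => simpa using f.toOrderHom.monotone (Fin.succ_le_succ_iff.1 hij) }
  map_id n := by
    ext i : 3
    induction i using Fin.cases <;> rfl
  map_comp f g := by
    ext i : 3
    induction i using Fin.cases <;> rfl

/-- The inclusion of the old vertices. -/
def shiftSucc : 𝟭 SimplexCategory ⟶ shift where
  app n := Hom.mk (Fin.succOrderEmb (n.len + 1)).toOrderHom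
  naturality m n f := by
    ext i : 3
    rfl

/-- The new vertex. -/
def shiftZero (n : SimplexCategory) : ⦋0⦌ ⟶ shift.obj n := SimplexCategory.const _ _ 0

lemma shiftZero_comp_map {m n : SimplexCategory} (f : m ⟶ n) :
    shiftZero m ≫ shift.map f = shiftZero n := by
  ext i : 3
  rfl

lemma shift_map_δ {n : ℕ} (i : Fin (n + 2)) : shift.map (δ i) = δ i.succ := by
  ext j : 3
  induction j using Fin.cases with
  | zero => exact (Fin.succ_succAbove_zero i).symm
  | succ j => exact (Fin.succ_succAbove_succ i j).symm

lemma shift_map_σ {n : ℕ} (i : Fin (n + 1)) : shift.map (σ i) = σ i.succ := by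
  ext j : 3
  induction j using Fin.cases with
  | zero => exact (Fin.predAbove_right_zero (i := i.succ)).symm
  | succ j => exact (Fin.succ_predAbove_succ i j).symm

/-- The degeneracy repeating the new vertex. -/
def shiftDegeneracy (n : SimplexCategory) : shift.obj (shift.obj n) ⟶ shift.obj n :=
  σ (n := n.len + 1) 0

/-- Naturality of the degeneracy that repeats the new vertex. It gives the compatibility of the
extra degeneracy with all faces and all degeneracies at once. -/
lemma shift_shift_map_comp {m n : SimplexCategory} (f : m ⟶ n) :
    shift.map (shift.map f) ≫ shiftDegeneracy n = shiftDegeneracy m ≫ shift.map f := by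
  ext j : 3
  induction j using Fin.cases <;> rfl

end SimplexCategory

namespace SimplicialObject

lemma map_op_comp_map_op {C : Type*} [Category* C] (X : SimplicialObject C)
    {k l m n : SimplexCategory} {f : k ⟶ l} {g : l ⟶ n} {f' : k ⟶ m} {g' : m ⟶ n}
    (h : f ≫ g = f' ≫ g') :
    X.map g.op ≫ X.map f.op = X.map g'.op ≫ X.map f'.op := by
  rw [← X.map_comp, ← X.map_comp, ← op_comp, ← op_comp, h]

lemma map_op_comp_map_op_eq_id {C : Type*} [Category* C] (X : SimplicialObject C)
    {m n : SimplexCategory} {f : n ⟶ m} {g : m ⟶ n} (h : f ≫ g = 𝟙 n) :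
    X.map g.op ≫ X.map f.op = 𝟙 _ := by
  rw [← X.map_comp, ← op_comp, h, op_id, X.map_id]

end SimplicialObject

namespace SimplicialModule

variable {A A' A'' B B' B'' C C' K K' : SimplicialModule.{u}}

/-! ### Décalage -/

/-- The décalage of a simplicial module, `(dec A)_n = A_{n + 1}`. -/
def dec (A : SimplicialModule.{u}) : SimplicialModule.{u} where
  obj n := A.obj (op (SimplexCategory.shift.obj n.unop))
  map θ := A.map (SimplexCategory.shift.map θ.unop).op
  map_id n := by
    rw [unop_id, CategoryTheory.Functor.map_id, op_id, A.map_id]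
  map_comp f g := by
    rw [unop_comp, Functor.map_comp, op_comp, A.map_comp]

/-- The décalage of a morphism. -/
def decMap (f : A ⟶ B) : dec A ⟶ dec B where
  app _ := f.app _
  naturality _ _ θ := f.naturality (SimplexCategory.shift.map θ.unop).op

/-- Forgetting the initial vertex. -/
def decFace (A : SimplicialModule.{u}) : dec A ⟶ A where
  app n := A.map (SimplexCategory.shiftSucc.app n.unop).op
  naturality m n θ := by
    change A.map _ ≫ A.map _ = A.map _ ≫ A.map θ
    rw [← A.map_comp, ← A.map_comp, ← op_comp, ← SimplexCategory.shiftSucc.naturality]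
    rfl

lemma decMap_comp_decFace (f : A ⟶ B) : decMap f ≫ decFace B = decFace A ≫ f := by
  refine NatTrans.ext (funext fun n => ?_)
  exact (f.naturality _).symm

/-- The constant simplicial module. -/
abbrev const (V : ModuleCat.{u} ℚ) : SimplicialModule.{u} := (SimplicialObject.const _).obj V

/-- The map of constant simplicial modules induced by a linear map. -/
abbrev constMap {V W : ModuleCat.{u} ℚ} (u : V ⟶ W) : const V ⟶ const W :=
  (SimplicialObject.const _).map u

/-- Restriction to the initial vertex. -/
def decVertex (A : SimplicialModule.{u}) : dec A ⟶ const (A _⦋0⦌) where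
  app n := A.map (SimplexCategory.shiftZero n.unop).op
  naturality m n θ := by
    change A.map _ ≫ A.map _ = A.map _ ≫ 𝟙 _
    rw [← A.map_comp, ← op_comp, SimplexCategory.shiftZero_comp_map, Category.comp_id]

lemma decMap_comp_decVertex (f : A ⟶ B) :
    decMap f ≫ decVertex B = decVertex A ≫ constMap (f.app _) := by
  refine NatTrans.ext (funext fun n => ?_)
  exact (f.naturality _).symm

/-- The décalage, augmented by the initial vertex. -/
def decAugmented (A : SimplicialModule.{u}) : SimplicialObject.Augmented (ModuleCat.{u} ℚ) where
  left := dec A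
  right := A _⦋0⦌
  hom := decVertex A

/-- The extra degeneracy of the décalage. -/
def decExtraDegeneracy (A : SimplicialModule.{u}) : (decAugmented A).ExtraDegeneracy where
  s' := A.σ 0
  s n := A.σ (n := n + 1) 0
  s'_comp_ε := SimplicialObject.map_op_comp_map_op_eq_id A (Subsingleton.elim _ _)
  s₀_comp_δ₁ := by
    refine SimplicialObject.map_op_comp_map_op A (f := SimplexCategory.shift.map _) ?_
    ext i : 3
    fin_cases i <;> rfl
  s_comp_δ₀ n := by
    refine SimplicialObject.map_op_comp_map_op_eq_id A (f := SimplexCategory.shift.map _) ?_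
    ext i : 3
    induction i using Fin.cases <;> rfl
  s_comp_δ n i := by
    refine SimplicialObject.map_op_comp_map_op A (f := SimplexCategory.shift.map _)
      (g' := SimplexCategory.shift.map _) ?_
    exact (congrArg (· ≫ _) (congrArg _ (SimplexCategory.shift_map_δ i).symm)).trans
      (SimplexCategory.shift_shift_map_comp _)
  s_comp_σ n i := by
    refine SimplicialObject.map_op_comp_map_op A (f := SimplexCategory.shift.map _)
      (g' := SimplexCategory.shift.map _) ?_
    exact (congrArg (· ≫ _) (congrArg _ (SimplexCategory.shift_map_σ i).symm)).trans
      (SimplexCategory.shift_shift_map_comp _)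

/-- The inclusion of the degenerate simplices on a vertex. -/
def fromConst (A : SimplicialModule.{u}) : const (A _⦋0⦌) ⟶ A where
  app n := A.map (SimplexCategory.const n.unop ⦋0⦌ 0).op
  naturality m n θ := by
    refine (Category.id_comp _).trans ?_
    exact (congrArg A.map (Subsingleton.elim _ _)).trans (A.map_comp _ θ)

lemma constMap_comp_fromConst (f : A ⟶ B) :
    constMap (f.app _) ≫ fromConst B = fromConst A ≫ f := by
  refine NatTrans.ext (funext fun n => ?_)
  exact (f.naturality _).symm

/-- The inclusion of the constant paths. -/
def decSection (A : SimplicialModule.{u}) : const (A _⦋0⦌) ⟶ dec A :=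
  (decExtraDegeneracy A).section_

lemma decSection_comp_decVertex (A : SimplicialModule.{u}) :
    decSection A ≫ decVertex A = 𝟙 _ :=
  (decExtraDegeneracy A).section_comp_hom

lemma decSection_comp_decFace (A : SimplicialModule.{u}) :
    decSection A ≫ decFace A = fromConst A := by
  refine NatTrans.ext (funext fun n => ?_)
  change (A.map _ ≫ A.map _) ≫ A.map _ = A.map _
  refine (congrArg (· ≫ _) (A.map_comp _ _).symm).trans ((A.map_comp _ _).symm.trans ?_)
  exact congrArg A.map (Subsingleton.elim _ _)

/-- A path contracts to its initial vertex. -/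
def decHomotopy (A : SimplicialModule.{u}) :
    SimplicialObject.Homotopy (decVertex A ≫ decSection A) (𝟙 (dec A)) :=
  (decExtraDegeneracy A).homotopy

/-- The two vertices of an edge give the same classes in the homology of `A ⊗ B`. -/
lemma homologyMap_vertex_eq (A B : SimplicialModule.{u}) (k : ℕ) :
    homologyMap k (tensorMap (constMap (A.δ (n := 0) 0) ≫ fromConst A) (𝟙 B)) =
      homologyMap k (tensorMap (constMap (A.δ (n := 0) 1) ≫ fromConst A) (𝟙 B)) := by
  -- An edge of `A` is a vertex of `dec A`. On constant families of edges, `decFace` returns the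
  -- final vertex, while contracting first returns the initial one.
  have H := ((decHomotopy A).precomp (fromConst (dec A))).postcomp (decFace A)
  have h := homologyMap_eq_of_homotopy k (tensorHomotopy H (.refl (𝟙 B)))
  have e₁ : (fromConst (dec A) ≫ 𝟙 (dec A)) ≫ decFace A =
      constMap (A.δ (n := 0) 0) ≫ fromConst A := by
    rw [Category.comp_id, ← constMap_comp_fromConst]
    congr 3
  have e₂ : (fromConst (dec A) ≫ decVertex A ≫ decSection A) ≫ decFace A =
      constMap (A.δ (n := 0) 1) ≫ fromConst A := by
    rw [Category.assoc, Category.assoc, decSection_comp_decFace, ← Category.assoc,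
      ← constMap_comp_fromConst]
    refine NatTrans.ext (funext fun n => ?_)
    refine congrArg (· ≫ _) ((Category.comp_id _).trans ?_)
    refine congrArg (fun f => A.map (Quiver.Hom.op f)) ?_
    ext i : 3
    fin_cases i; rfl
  rw [← e₁, ← e₂]
  exact h.symm

/-! ### Connected components -/

/-- The module of connected components of a simplicial module. -/
def π₀ (A : SimplicialModule.{u}) : ModuleCat.{u} ℚ :=
  ModuleCat.of ℚ (A _⦋0⦌ ⧸ LinearMap.range ((A.δ (n := 0) 0).hom - (A.δ 1).hom))

/-- The component of a vertex. -/
def π₀Mk (A : SimplicialModule.{u}) : A _⦋0⦌ ⟶ π₀ A :=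
  ModuleCat.ofHom (Submodule.mkQ _)

lemma π₀Mk_surjective (A : SimplicialModule.{u}) : Function.Surjective (π₀Mk A).hom :=
  Submodule.mkQ_surjective _

lemma π₀Mk_eq_zero_iff (A : SimplicialModule.{u}) (v : A _⦋0⦌) :
    (π₀Mk A).hom v = 0 ↔ ∃ c : A _⦋1⦌, (A.δ (n := 0) 0).hom c - (A.δ 1).hom c = v :=
  (Submodule.Quotient.mk_eq_zero _).trans LinearMap.mem_range

lemma δ_comp_π₀Mk (A : SimplicialModule.{u}) :
    A.δ (n := 0) 0 ≫ π₀Mk A = A.δ 1 ≫ π₀Mk A := by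
  ext c
  refine sub_eq_zero.1 ((map_sub (π₀Mk A).hom _ _).symm.trans ?_)
  exact (π₀Mk_eq_zero_iff A _).2 ⟨c, rfl⟩

/-- Any two vertices of a simplex are joined by one of its edges. -/
lemma map_comp_π₀Mk (A : SimplicialModule.{u}) (n : SimplexCategory) (g₁ g₂ : ⦋0⦌ ⟶ n) :
    A.map g₁.op ≫ π₀Mk A = A.map g₂.op ≫ π₀Mk A := by
  induction n using SimplexCategory.rec with | _ n
  wlog h : g₁.toOrderHom 0 ≤ g₂.toOrderHom 0 generalizing g₁ g₂
  · exact (this g₂ g₁ (le_of_not_ge h)).symm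
  obtain ⟨e, h₁, h₂⟩ : ∃ e : ⦋1⦌ ⟶ ⦋n⦌, g₁ = SimplexCategory.δ 1 ≫ e ∧
      g₂ = SimplexCategory.δ 0 ≫ e := by
    refine ⟨SimplexCategory.mkOfLe _ _ h, ?_, ?_⟩ <;>
    · ext i : 3
      fin_cases i; rfl
  rw [h₁, h₂, op_comp, op_comp, A.map_comp, A.map_comp, Category.assoc, Category.assoc]
  exact congrArg (_ ≫ ·) (δ_comp_π₀Mk A).symm

/-- The projection onto the module of connected components. -/
def toπ₀ (A : SimplicialModule.{u}) : A ⟶ const (π₀ A) :=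
  (A.augment (π₀ A) (π₀Mk A) (map_comp_π₀Mk A)).hom

/-- `fromConst` is not a section of `toπ₀`, being defined on vertices rather than components, but it
lifts the projection `π₀Mk`. That is enough to split `toπ₀` after passing to homology. -/
lemma fromConst_comp_toπ₀ (A : SimplicialModule.{u}) :
    fromConst A ≫ toπ₀ A = constMap (π₀Mk A) := by
  refine NatTrans.ext (funext fun n => ?_)
  change A.map _ ≫ A.map _ ≫ π₀Mk A = π₀Mk A
  refine (Category.assoc _ _ _).symm.trans ((congrArg (· ≫ _) ?_).trans (Category.id_comp _))
  exact SimplicialObject.map_op_comp_map_op_eq_id A (Subsingleton.elim _ _)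

lemma toπ₀_surjective (A : SimplicialModule.{u}) (n) :
    Function.Surjective ((toπ₀ A).app n).hom := fun y => by
  obtain ⟨v, rfl⟩ := π₀Mk_surjective A y
  exact ⟨((fromConst A).app n).hom v,
    congrArg (fun φ : const (A _⦋0⦌) ⟶ const (π₀ A) => (φ.app n).hom v) (fromConst_comp_toπ₀ A)⟩

/-- The map induced on connected components. -/
def π₀Map (f : A ⟶ B) : π₀ A ⟶ π₀ B :=
  ModuleCat.ofHom (Submodule.mapQ _ _ (f.app (op ⦋0⦌)).hom (by
    rintro _ ⟨c, rfl⟩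
    refine ⟨(f.app (op ⦋1⦌)).hom c, ?_⟩
    refine Eq.trans ?_ (map_sub _ _ _).symm
    exact congrArg₂ (· - ·) (congrArg (fun φ => φ.hom c) (f.naturality _)).symm
      (congrArg (fun φ => φ.hom c) (f.naturality _)).symm))

lemma π₀Mk_comp_π₀Map (f : A ⟶ B) : π₀Mk A ≫ π₀Map f = f.app _ ≫ π₀Mk B := rfl

lemma toπ₀_comp_constMap (f : A ⟶ B) : toπ₀ A ≫ constMap (π₀Map f) = f ≫ toπ₀ B := by
  refine NatTrans.ext (funext fun n => ?_)
  change (A.map _ ≫ π₀Mk A) ≫ π₀Map f = f.app n ≫ B.map _ ≫ π₀Mk B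
  rw [Category.assoc, π₀Mk_comp_π₀Map, f.naturality_assoc]

/-! ### Loops -/

/-- The part of a simplicial module whose vertices lie in the zero component. -/
abbrev reduced (A : SimplicialModule.{u}) : SimplicialModule.{u} := ker (toπ₀ A)

/-- The simplicial module of paths starting at zero. -/
abbrev path (A : SimplicialModule.{u}) : SimplicialModule.{u} := ker (decVertex A)

lemma decFace_comp_toπ₀ (A : SimplicialModule.{u}) :
    decFace A ≫ toπ₀ A = decVertex A ≫ constMap (π₀Mk A) := by
  refine NatTrans.ext (funext fun n => ?_)
  change A.map _ ≫ A.map _ ≫ π₀Mk A = A.map _ ≫ π₀Mk A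
  rw [← A.map_comp_assoc, ← op_comp]
  exact map_comp_π₀Mk A _ _ _

/-- The end point of a path. -/
def pathEnd (A : SimplicialModule.{u}) : path A ⟶ reduced A :=
  kerLift _ (kerι (decVertex A) ≫ decFace A) (by
    rw [Category.assoc, decFace_comp_toπ₀, kerι_comp_assoc, Limits.zero_comp])

lemma pathEnd_comp_kerι (A : SimplicialModule.{u}) :
    pathEnd A ≫ kerι (toπ₀ A) = kerι (decVertex A) ≫ decFace A := rfl

lemma map_op_apply (A : SimplicialModule.{u}) {l m n : SimplexCategory} (f : l ⟶ m) (g : m ⟶ n)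
    (x : A.obj (op n)) :
    (A.map f.op).hom ((A.map g.op).hom x) = (A.map (f ≫ g).op).hom x := by
  rw [op_comp, A.map_comp]; rfl

/-- The degenerate simplex `r^* a` is a path ending at `a`, but it starts at the first vertex of
`a`. As that vertex lies in the zero component, it bounds an edge, and this edge corrects the
starting point without changing the end. -/
lemma pathEnd_surjective (A : SimplicialModule.{u}) (n) :
    Function.Surjective ((pathEnd A).app n).hom := by
  rintro ⟨a, ha⟩
  induction n using Opposite.rec with | _ n
  let r : SimplexCategory.shift.obj n ⟶ n := SimplexCategory.Hom.mk
    ⟨Fin.cases 0 id, fun i j hij => by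
      induction i using Fin.cases with
      | zero => exact Fin.zero_le _
      | succ i =>
        induction j using Fin.cases with
        | zero => exact absurd hij (by simp)
        | succ j => exact Fin.succ_le_succ_iff.1 hij⟩
  let q : SimplexCategory.shift.obj n ⟶ ⦋1⦌ := SimplexCategory.Hom.mk
    ⟨Fin.cases 0 fun _ => 1, fun i j hij => by
      induction i using Fin.cases with
      | zero => exact Fin.zero_le _
      | succ i =>
        induction j using Fin.cases with
        | zero => exact absurd hij (by simp)
        | succ j => exact le_rfl⟩
  obtain ⟨c, hc⟩ := (π₀Mk_eq_zero_iff A _).1 ha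
  -- Subtracting a degenerate edge moves the final vertex of `c` to zero; the initial vertex becomes
  -- minus the first vertex of `a`.
  let c' := c - (A.map (SimplexCategory.σ (n := 0) 0).op).hom ((A.δ (n := 0) 0).hom c)
  have hc₀ : (A.map (SimplexCategory.δ (n := 0) 0).op).hom c' = 0 := by
    refine (map_sub _ _ _).trans (sub_eq_zero.2 ?_)
    rw [map_op_apply, Subsingleton.elim (_ ≫ _) (𝟙 _), op_id, A.map_id]
    rfl
  have hc₁ : (A.map (SimplexCategory.δ (n := 0) 1).op).hom c' =
      -(A.map (SimplexCategory.const ⦋0⦌ n 0).op).hom a := by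
    refine (map_sub _ _ _).trans ?_
    rw [map_op_apply, Subsingleton.elim (_ ≫ _) (𝟙 _), op_id, A.map_id]
    refine Eq.trans ?_ (congrArg Neg.neg hc)
    exact (neg_sub _ _).symm
  -- `q` sends the new vertex to 0 and all others to 1. So `q^* c'` cancels the initial vertex of
  -- `r^* a`, and its end is degenerate on the final vertex of `c'`, which is zero.
  refine ⟨⟨(A.map r.op).hom a + (A.map q.op).hom c', ?_⟩, Subtype.ext ?_⟩
  · refine (map_add _ _ _).trans ?_
    refine (congrArg₂ (· + ·) (map_op_apply A _ _ _) (map_op_apply A _ _ _)).trans ?_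
    refine Eq.trans ?_ (add_neg_cancel ((A.map (SimplexCategory.const ⦋0⦌ n 0).op).hom a))
    refine congrArg₂ (· + ·) ?_ (Eq.trans ?_ hc₁)
    · refine congrArg (fun f => (A.map (Quiver.Hom.op f)).hom a) ?_
      ext i : 3
      fin_cases i; rfl
    · refine congrArg (fun f => (A.map (Quiver.Hom.op f)).hom c') ?_
      ext i : 3
      fin_cases i; rfl
  · refine (map_add ((decFace A).app (op n)).hom _ _).trans ?_
    refine (congrArg₂ (· + ·) (map_op_apply A _ _ _) (map_op_apply A _ _ _)).trans ?_
    refine Eq.trans ?_ (add_zero a)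
    refine congrArg₂ (· + ·) ?_ ?_
    · refine Eq.trans ?_ (congrArg (fun φ => φ.hom a) (A.map_id (op n)))
      refine congrArg (fun f => (A.map (Quiver.Hom.op f)).hom a) ?_
      ext i : 3
      rfl
    · refine Eq.trans ?_ ((congrArg (A.map (SimplexCategory.const n ⦋0⦌ 0).op).hom hc₀).trans
        (map_zero _))
      rw [map_op_apply]
      refine congrArg (fun f => (A.map (Quiver.Hom.op f)).hom c') ?_
      ext i : 3
      rfl

/-- The simplicial module of loops at zero. -/
abbrev loops (A : SimplicialModule.{u}) : SimplicialModule.{u} := ker (pathEnd A)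

/-- The map induced on reduced parts. -/
def reducedMap (f : A ⟶ B) : reduced A ⟶ reduced B :=
  kerMap f (constMap (π₀Map f)) (toπ₀_comp_constMap f)

lemma reducedMap_comp_kerι (f : A ⟶ B) :
    reducedMap f ≫ kerι (toπ₀ B) = kerι (toπ₀ A) ≫ f := rfl

/-- The map induced on paths. -/
def pathMap (f : A ⟶ B) : path A ⟶ path B :=
  kerMap (decMap f) (constMap (f.app _)) (decMap_comp_decVertex f).symm

lemma pathMap_comp_kerι (f : A ⟶ B) :
    pathMap f ≫ kerι (decVertex B) = kerι (decVertex A) ≫ decMap f := rfl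

lemma pathEnd_comp_reducedMap (f : A ⟶ B) :
    pathEnd A ≫ reducedMap f = pathMap f ≫ pathEnd B := by
  refine (cancel_mono (kerι (toπ₀ B))).1 ?_
  rw [Category.assoc, Category.assoc, reducedMap_comp_kerι, pathEnd_comp_kerι,
    ← Category.assoc, ← Category.assoc, pathEnd_comp_kerι, pathMap_comp_kerι,
    Category.assoc, Category.assoc, decMap_comp_decFace]

/-- The map induced on loops. -/
def loopsMap (f : A ⟶ B) : loops A ⟶ loops B :=
  kerMap (pathMap f) (reducedMap f) (pathEnd_comp_reducedMap f)

/-- Paths starting at zero are contractible. -/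
lemma subsingleton_homology_path (A B : SimplicialModule.{u}) (k : ℕ) :
    Subsingleton (homology k (tensor (path A) B)) := by
  -- Subtracting the constant path at the initial vertex retracts `dec A` onto the paths from zero.
  -- Through `r`, the contraction of `dec A` becomes a homotopy from zero to the identity of `path
  -- A`.
  let r : dec A ⟶ path A := kerLift (decVertex A) (𝟙 _ - decVertex A ≫ decSection A) (by
    rw [Preadditive.sub_comp, Category.assoc, decSection_comp_decVertex, Category.comp_id,
      Category.id_comp, sub_self])
  have hr : kerι (decVertex A) ≫ r = 𝟙 (path A) := by
    refine (cancel_mono (kerι (decVertex A))).1 ?_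
    rw [Category.assoc, kerLift_ι, Preadditive.comp_sub, kerι_comp_assoc, Limits.zero_comp,
      sub_zero, Category.comp_id, Category.id_comp]
  have H := ((decHomotopy A).precomp (kerι (decVertex A))).postcomp r
  have h := homologyMap_eq_of_homotopy k (tensorHomotopy H (.refl (𝟙 B)))
  rw [Category.comp_id, hr, kerι_comp_assoc, Limits.zero_comp, Limits.zero_comp,
    tensorMap_zero_left, homologyMap_zero, tensorMap_id, homologyMap_id] at h
  exact ⟨fun x y => (LinearMap.congr_fun h x).symm.trans (LinearMap.congr_fun h y)⟩

end SimplicialModule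

/-! ### Linear algebra -/

section LinearAlgebra

variable {K : Type*} [DivisionRing K]

/-- Exactness is recast as an equation between maps so that it can be transported by an additive
functor. Here `s` inverts `v` on its range, and `r` inverts `u` on the values of `id - s v`. -/
lemma Function.Exact.exists_splitting {V W Z : Type*} [AddCommGroup V] [Module K V]
    [AddCommGroup W] [Module K W] [AddCommGroup Z] [Module K Z] {u : V →ₗ[K] W} {v : W →ₗ[K] Z}
    (h : Function.Exact u v) :
    ∃ (r : W →ₗ[K] V) (s : Z →ₗ[K] W), u ∘ₗ r + s ∘ₗ v = LinearMap.id := by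
  obtain ⟨s₀, hs₀⟩ := v.rangeRestrict.exists_rightInverse_of_surjective v.range_rangeRestrict
  obtain ⟨s, hs⟩ := LinearMap.exists_extend s₀
  obtain ⟨t, ht⟩ := u.rangeRestrict.exists_rightInverse_of_surjective u.range_rangeRestrict
  have hv (x : W) : v (s (v x)) = v x := by
    have h₁ := LinearMap.congr_fun hs (v.rangeRestrict x)
    have h₂ := congrArg Subtype.val (LinearMap.congr_fun hs₀ (v.rangeRestrict x))
    exact (congrArg v h₁).trans h₂
  have hu (x : W) : (LinearMap.id - s ∘ₗ v : W →ₗ[K] W) x ∈ LinearMap.range u :=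
    (h _).1 (by simp only [LinearMap.sub_apply, LinearMap.id_apply, LinearMap.comp_apply,
      map_sub, hv, sub_self])
  refine ⟨t ∘ₗ (LinearMap.id - s ∘ₗ v).codRestrict (LinearMap.range u) hu, s,
    LinearMap.ext fun x => ?_⟩
  have := congrArg Subtype.val (LinearMap.congr_fun ht
    ((LinearMap.id - s ∘ₗ v).codRestrict (LinearMap.range u) hu x))
  exact (congrArg (· + s (v x)) this).trans (sub_add_cancel x (s (v x)))

lemma LinearMap.exists_comp_eq_id_of_surjective {V W : Type*} [AddCommGroup V] [Module K V]
    [AddCommGroup W] [Module K W] {u : V →ₗ[K] W} (h : Function.Surjective u) :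
    ∃ s : W →ₗ[K] V, u ∘ₗ s = LinearMap.id :=
  u.exists_rightInverse_of_surjective (LinearMap.range_eq_top.2 h)

lemma LinearMap.exists_comp_eq_id_of_injective {V W : Type*} [AddCommGroup V] [Module K V]
    [AddCommGroup W] [Module K W] {u : V →ₗ[K] W} (h : Function.Injective u) :
    ∃ s : W →ₗ[K] V, s ∘ₗ u = LinearMap.id :=
  u.exists_leftInverse_of_injective (LinearMap.ker_eq_bot.2 h)

variable {M₁ M₂ M₃ N₁ N₂ N₃ : Type u} [AddCommGroup M₁] [Module K M₁] [AddCommGroup M₂]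
  [Module K M₂] [AddCommGroup M₃] [Module K M₃] [AddCommGroup N₁] [Module K N₁] [AddCommGroup N₂]
  [Module K N₂] [AddCommGroup N₃] [Module K N₃]

/-- The left half of the snake lemma: the kernels form a left exact sequence, and `hs` supplies
surjectivity at its right end. -/
lemma LinearMap.rank_ker_eq_add_of_exact {i : M₁ →ₗ[K] M₂} {p : M₂ →ₗ[K] M₃} {i' : N₁ →ₗ[K] N₂}
    {p' : N₂ →ₗ[K] N₃} {φ₁ : M₁ →ₗ[K] N₁} {φ₂ : M₂ →ₗ[K] N₂} {φ₃ : M₃ →ₗ[K] N₃}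
    (hi : Function.Injective i) (he : Function.Exact i p) (hi' : Function.Injective i')
    (h₁ : φ₂ ∘ₗ i = i' ∘ₗ φ₁) (h₂ : φ₃ ∘ₗ p = p' ∘ₗ φ₂)
    (hs : ∀ y, φ₃ y = 0 → ∃ x, φ₂ x = 0 ∧ p x = y) :
    Module.rank K (LinearMap.ker φ₂) =
      Module.rank K (LinearMap.ker φ₁) + Module.rank K (LinearMap.ker φ₃) := by
  let q : LinearMap.ker φ₂ →ₗ[K] LinearMap.ker φ₃ := p.restrict fun x hx =>
    (LinearMap.congr_fun h₂ x).trans ((congrArg p' hx).trans (map_zero p'))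
  have hq : Function.Surjective q := fun y => by
    obtain ⟨x, hx, hy⟩ := hs y.1 y.2
    exact ⟨⟨x, hx⟩, Subtype.ext hy⟩
  let j : LinearMap.ker φ₁ →ₗ[K] LinearMap.ker q :=
    (i.restrict (p := LinearMap.ker φ₁) (q := LinearMap.ker φ₂) fun x hx =>
      (LinearMap.congr_fun h₁ x).trans ((congrArg i' hx).trans (map_zero i'))).codRestrict _
      fun x => Subtype.ext (he.apply_apply_eq_zero x.1)
  have hj : Function.Bijective j := by
    refine ⟨fun x y hxy => Subtype.ext (hi ?_), fun y => ?_⟩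
    · exact congrArg (fun z => (z.1 : M₂)) hxy
    · obtain ⟨x, hx⟩ := (he y.1.1).1 (congrArg Subtype.val y.2)
      refine ⟨⟨x, hi' ?_⟩, Subtype.ext (Subtype.ext hx)⟩
      refine (LinearMap.congr_fun h₁ x).symm.trans ?_
      exact (congrArg φ₂ hx).trans (y.1.2.trans (map_zero i').symm)
  rw [LinearMap.rank_eq_of_surjective hq, add_comm, (LinearEquiv.ofBijective j hj).rank_eq]

lemma LinearMap.rank_ker_eq_of_equiv {φ₁ : M₁ →ₗ[K] N₁} {φ₂ : M₂ →ₗ[K] N₂} (e : M₁ ≃ₗ[K] M₂)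
    (e' : N₁ ≃ₗ[K] N₂) (h : ∀ x, e' (φ₁ x) = φ₂ (e x)) :
    Module.rank K (LinearMap.ker φ₁) = Module.rank K (LinearMap.ker φ₂) := by
  have key : (LinearMap.ker φ₁).map (e : M₁ →ₗ[K] M₂) = LinearMap.ker φ₂ := by
    ext y
    constructor
    · rintro ⟨x, hx, rfl⟩
      exact (h x).symm.trans ((congrArg e' hx).trans (map_zero e'))
    · intro hy
      refine ⟨e.symm y, e'.injective ?_, e.apply_symm_apply y⟩
      rw [h, LinearEquiv.apply_symm_apply, map_zero]
      exact hy
  exact ((e.submoduleMap (LinearMap.ker φ₁)).trans (LinearEquiv.ofEq _ _ key)).rank_eq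

end LinearAlgebra

namespace SimplicialModule

variable {A A' A'' B B' B'' C C' K K' : SimplicialModule.{u}}

/-! ### Products with constant simplicial modules -/

lemma constMap_id (V : ModuleCat.{u} ℚ) : constMap (𝟙 V) = 𝟙 (const V) := rfl

lemma homologyMap_constMap_comp (k : ℕ) {U V W : ModuleCat.{u} ℚ} (u : U ⟶ V) (v : V ⟶ W)
    (B : SimplicialModule.{u}) :
    homologyMap k (tensorMap (constMap (u ≫ v)) (𝟙 B)) =
      homologyMap k (tensorMap (constMap v) (𝟙 B)) ∘ₗ
        homologyMap k (tensorMap (constMap u) (𝟙 B)) := by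
  rw [← homologyMap_comp, ← tensorMap_comp, Category.comp_id]
  congr 2

lemma homologyMap_constMap_surjective (k : ℕ) {V W : ModuleCat.{u} ℚ} {u : V ⟶ W}
    (hu : Function.Surjective u.hom) (B : SimplicialModule.{u}) :
    Function.Surjective (homologyMap k (tensorMap (constMap u) (𝟙 B))) := fun y => by
  obtain ⟨s, hs⟩ := LinearMap.exists_comp_eq_id_of_surjective hu
  refine ⟨homologyMap k (tensorMap (constMap (ModuleCat.ofHom s)) (𝟙 B)) y, ?_⟩
  have e : ModuleCat.ofHom s ≫ u = 𝟙 W := ModuleCat.hom_ext hs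
  have h := homologyMap_constMap_comp k (ModuleCat.ofHom s) u B
  rw [e, constMap_id, tensorMap_id, homologyMap_id] at h
  exact (LinearMap.congr_fun h y).symm

lemma homologyMap_constMap_injective (k : ℕ) {V W : ModuleCat.{u} ℚ} {u : V ⟶ W}
    (hu : Function.Injective u.hom) (B : SimplicialModule.{u}) :
    Function.Injective (homologyMap k (tensorMap (constMap u) (𝟙 B))) := by
  obtain ⟨s, hs⟩ := LinearMap.exists_comp_eq_id_of_injective hu
  have e : u ≫ ModuleCat.ofHom s = 𝟙 V := ModuleCat.hom_ext hs
  have h := homologyMap_constMap_comp k u (ModuleCat.ofHom s) B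
  rw [e, constMap_id, tensorMap_id, homologyMap_id] at h
  exact Function.LeftInverse.injective fun y => (LinearMap.congr_fun h y).symm

/-- The assignment `V ↦ H_k(const V ⊗ B)` is an additive functor, so it preserves the equation `u r
+ s v = id` along with `v u = 0`. -/
lemma homologyMap_constMap_exact (k : ℕ) {U V W : ModuleCat.{u} ℚ} {u : U ⟶ V} {v : V ⟶ W}
    (h : Function.Exact u.hom v.hom) (B : SimplicialModule.{u}) :
    Function.Exact (homologyMap k (tensorMap (constMap u) (𝟙 B)))
      (homologyMap k (tensorMap (constMap v) (𝟙 B))) := by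
  obtain ⟨r, s, hrs⟩ := h.exists_splitting
  have e : ModuleCat.ofHom r ≫ u + v ≫ ModuleCat.ofHom s = 𝟙 V := ModuleCat.hom_ext hrs
  have e' : constMap (ModuleCat.ofHom r ≫ u) + constMap (v ≫ ModuleCat.ofHom s) = 𝟙 (const V) := by
    rw [← constMap_id, ← e]; rfl
  have h₁ : LinearMap.id = homologyMap k (tensorMap (constMap u) (𝟙 B)) ∘ₗ
      homologyMap k (tensorMap (constMap (ModuleCat.ofHom r)) (𝟙 B)) +
      homologyMap k (tensorMap (constMap (ModuleCat.ofHom s)) (𝟙 B)) ∘ₗ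
      homologyMap k (tensorMap (constMap v) (𝟙 B)) := by
    rw [← homologyMap_constMap_comp, ← homologyMap_constMap_comp, ← homologyMap_add,
      ← tensorMap_add_left, e', tensorMap_id, homologyMap_id]
  have h₂ : homologyMap k (tensorMap (constMap v) (𝟙 B)) ∘ₗ
      homologyMap k (tensorMap (constMap u) (𝟙 B)) = 0 := by
    have e'' : constMap (u ≫ v) = 0 := by
      refine NatTrans.ext (funext fun n => ModuleCat.hom_ext h.linearMap_comp_eq_zero)
    rw [← homologyMap_constMap_comp, e'', tensorMap_zero_left, homologyMap_zero]
  intro x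
  refine ⟨fun hx => ?_, ?_⟩
  · have := LinearMap.congr_fun h₁ x
    simp only [LinearMap.id_apply, LinearMap.add_apply, LinearMap.comp_apply, hx, map_zero,
      add_zero] at this
    exact ⟨_, this.symm⟩
  · rintro ⟨y, rfl⟩
    exact LinearMap.congr_fun h₂ y

/-- The inclusion `b ↦ v ⊗ b`. -/
def constTensorι {V : ModuleCat.{u} ℚ} (v : V) (B : SimplicialModule.{u}) :
    B ⟶ tensor (const V) B where
  app n := ModuleCat.ofHom (TensorProduct.mk ℚ V (B.obj n) v)

/-- The evaluation `v ⊗ b ↦ φ v • b`. -/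
def constTensorEval {V : ModuleCat.{u} ℚ} (φ : V →ₗ[ℚ] ℚ) (B : SimplicialModule.{u}) :
    tensor (const V) B ⟶ B where
  app n := ModuleCat.ofHom (TensorProduct.lid ℚ (B.obj n) ∘ₗ φ.rTensor (B.obj n))
  naturality m n θ := by
    refine ModuleCat.hom_ext (TensorProduct.ext' fun v b => ?_)
    exact (map_smul (B.map θ).hom (φ v) b).symm

lemma constTensorι_comp_tensorMap {V : ModuleCat.{u} ℚ} (v : V) (g : B ⟶ B') :
    constTensorι v B ≫ tensorMap (𝟙 (const V)) g = g ≫ constTensorι v B' := rfl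

lemma constTensorι_comp_constTensorEval_self {V : ModuleCat.{u} ℚ} {v : V} {φ : V →ₗ[ℚ] ℚ}
    (h : φ v = 1) : constTensorι v B ≫ constTensorEval φ B = 𝟙 B := by
  ext n b
  change φ v • b = b
  rw [h, one_smul]

lemma constTensorι_comp_constTensorEval_zero {V : ModuleCat.{u} ℚ} {v : V} {φ : V →ₗ[ℚ] ℚ}
    (h : φ v = 0) : constTensorι v B ≫ constTensorEval φ B = 0 := by
  ext n b
  change φ v • b = 0
  rw [h, zero_smul]

/-- The cross product with a basis of vertices. -/
def constTensorSum (k : ℕ) {V : ModuleCat.{u} ℚ} {ι : Type u} (b : Module.Basis ι ℚ V)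
    (B : SimplicialModule.{u}) : (ι →₀ homology k B) →ₗ[ℚ] homology k (tensor (const V) B) :=
  Finsupp.lsum ℚ fun i => homologyMap k (constTensorι (b i) B)

/-- Evaluating at the `i`-th coordinate functional recovers the `i`-th component. No finiteness is
needed, so lower bounds hold for every `V`. -/
lemma constTensorSum_injective (k : ℕ) {V : ModuleCat.{u} ℚ} {ι : Type u}
    (b : Module.Basis ι ℚ V) (B : SimplicialModule.{u}) :
    Function.Injective (constTensorSum k b B) := by
  classical
  have h (i : ι) : homologyMap k (constTensorEval (b.coord i) B) ∘ₗ constTensorSum k b B =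
      Finsupp.lapply i := by
    refine Finsupp.lhom_ext' fun j => LinearMap.ext fun x => ?_
    simp only [constTensorSum, LinearMap.comp_apply, Finsupp.lsingle_apply,
      Finsupp.lsum_single, Finsupp.lapply_apply]
    rw [← homologyMap_comp_apply]
    by_cases hij : j = i
    · subst hij
      rw [constTensorι_comp_constTensorEval_self (by simp), homologyMap_id]
      simp
    · rw [constTensorι_comp_constTensorEval_zero (by simp [hij]), homologyMap_zero]
      simp [hij]
  refine (injective_iff_map_eq_zero _).2 fun x hx => Finsupp.ext fun i => ?_
  refine (LinearMap.congr_fun (h i) x).symm.trans ?_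
  rw [LinearMap.comp_apply, hx, map_zero]
  rfl

lemma sum_app_apply {ι : Type*} (s : Finset ι) (f : ι → (A ⟶ B)) (n) (x : A.obj n) :
    ((∑ i ∈ s, f i).app n).hom x = ∑ i ∈ s, ((f i).app n).hom x :=
  map_sum ({ toFun := fun φ => (φ.app n).hom x, map_zero' := rfl, map_add' := fun _ _ => rfl } :
    (A ⟶ B) →+ B.obj n) f s

/-- For a finite basis the identity of `V ⊗ B` is the sum of the coordinate projections followed by
the basis inclusions. -/
lemma constTensorSum_surjective (k : ℕ) {V : ModuleCat.{u} ℚ} {ι : Type u} [Finite ι]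
    (b : Module.Basis ι ℚ V) (B : SimplicialModule.{u}) :
    Function.Surjective (constTensorSum k b B) := fun x => by
  classical
  have := Fintype.ofFinite ι
  have e : ∑ i, constTensorEval (b.coord i) B ≫ constTensorι (b i) B = 𝟙 _ := by
    refine tensor_hom_ext fun n v y => ?_
    have h₁ : ((∑ i, constTensorEval (b.coord i) B ≫ constTensorι (b i) B).app n).hom (v ⊗ₜ y) =
        ∑ i, b i ⊗ₜ[ℚ] (b.coord i v • y) := sum_app_apply _ _ n _
    refine h₁.trans ?_
    simp_rw [← TensorProduct.smul_tmul, Module.Basis.coord_apply]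
    rw [← TensorProduct.sum_tmul, b.sum_repr]
    rfl
  refine ⟨Finsupp.equivFunOnFinite.symm
    fun i => homologyMap k (constTensorEval (b.coord i) B) x, ?_⟩
  have h := LinearMap.congr_fun (congrArg (homologyMap k) e) x
  rw [homologyMap_sum, homologyMap_id] at h
  refine Eq.trans ?_ h
  rw [constTensorSum, Finsupp.lsum_apply, Finsupp.sum_fintype _ _ (by simp), LinearMap.sum_apply]
  exact Finset.sum_congr rfl fun i _ => (homologyMap_comp_apply k _ _ _).symm

lemma rank_mul_rank_homology_le (k : ℕ) (V : ModuleCat.{u} ℚ) (B : SimplicialModule.{u}) :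
    Module.rank ℚ V * Module.rank ℚ (homology k B) ≤
      Module.rank ℚ (homology k (tensor (const V) B)) := by
  have b := Module.Free.chooseBasis ℚ V
  have := LinearMap.rank_le_of_injective _ (constTensorSum_injective k b B)
  rw [rank_finsupp', b.mk_eq_rank''] at this
  exact this

lemma rank_homology_const_tensor_le (k : ℕ) (V : ModuleCat.{u} ℚ) [Module.Finite ℚ V]
    (B : SimplicialModule.{u}) :
    Module.rank ℚ (homology k (tensor (const V) B)) ≤
      Module.rank ℚ V * Module.rank ℚ (homology k B) := by
  have b := Module.Free.chooseBasis ℚ V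
  rw [← b.mk_eq_rank'', ← rank_finsupp',
    LinearMap.rank_eq_of_surjective (constTensorSum_surjective k b B)]
  exact le_self_add

lemma rank_mul_rank_ker_le (k : ℕ) (V : ModuleCat.{u} ℚ) (g : B ⟶ B') :
    Module.rank ℚ V * Module.rank ℚ (LinearMap.ker (homologyMap k g)) ≤
      Module.rank ℚ (LinearMap.ker (homologyMap k (tensorMap (𝟙 (const V)) g))) := by
  have b := Module.Free.chooseBasis ℚ V
  let Φ := (constTensorSum k b B ∘ₗ
    Finsupp.mapRange.linearMap (LinearMap.ker (homologyMap k g)).subtype).codRestrict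
      (LinearMap.ker (homologyMap k (tensorMap (𝟙 (const V)) g))) fun x => by
    refine LinearMap.congr_fun (f := homologyMap k (tensorMap (𝟙 (const V)) g) ∘ₗ
      constTensorSum k b B ∘ₗ
        Finsupp.mapRange.linearMap (LinearMap.ker (homologyMap k g)).subtype) (g := 0) ?_ x
    refine Finsupp.lhom_ext fun i y => ?_
    simp only [constTensorSum, LinearMap.comp_apply, Finsupp.mapRange.linearMap_apply,
      Finsupp.mapRange_single, Finsupp.lsum_single, LinearMap.zero_apply]
    rw [← homologyMap_comp_apply, constTensorι_comp_tensorMap, homologyMap_comp_apply]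
    exact (congrArg _ y.2).trans (map_zero _)
  have hΦ : Function.Injective Φ := by
    refine (LinearMap.injective_codRestrict_iff _).2 ?_
    refine (constTensorSum_injective k b B).comp ?_
    exact Finsupp.mapRange_injective _ rfl Subtype.val_injective
  have := LinearMap.rank_le_of_injective Φ hΦ
  rw [rank_finsupp', b.mk_eq_rank''] at this
  exact this

end SimplicialModule

namespace SimplicialModule

variable {A A' A'' B B' B'' C C' K K' : SimplicialModule.{u}}

/-! ### Splitting off the components -/

lemma levelExact_toπ₀_tensor (A B : SimplicialModule.{u}) :
    LevelExact (tensorMap (kerι (toπ₀ A)) (𝟙 B)) (tensorMap (toπ₀ A) (𝟙 B)) :=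
  (levelExact_kerι (toπ₀_surjective A)).tensor B

lemma levelExact_pathEnd_tensor (A B : SimplicialModule.{u}) :
    LevelExact (tensorMap (kerι (pathEnd A)) (𝟙 B)) (tensorMap (pathEnd A) (𝟙 B)) :=
  (levelExact_kerι (pathEnd_surjective A)).tensor B

lemma tensorMap_fromConst_comp_toπ₀ (A B : SimplicialModule.{u}) :
    tensorMap (fromConst A) (𝟙 B) ≫ tensorMap (toπ₀ A) (𝟙 B) =
      tensorMap (constMap (π₀Mk A)) (𝟙 B) := by
  rw [← tensorMap_comp, fromConst_comp_toπ₀, Category.comp_id]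

lemma homologyMap_toπ₀_surjective (A B : SimplicialModule.{u}) (k : ℕ) :
    Function.Surjective (homologyMap k (tensorMap (toπ₀ A) (𝟙 B))) := by
  have h := homologyMap_constMap_surjective k (π₀Mk_surjective A) B
  rw [← tensorMap_fromConst_comp_toπ₀, homologyMap_comp, LinearMap.coe_comp] at h
  exact h.of_comp

/-- `toπ₀` is surjective on homology one degree higher, so the connecting map vanishes. -/
lemma homologyMap_reduced_injective (A B : SimplicialModule.{u}) (k : ℕ) :
    Function.Injective (homologyMap k (tensorMap (kerι (toπ₀ A)) (𝟙 B))) := by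
  refine (injective_iff_map_eq_zero _).2 fun x hx => ?_
  obtain ⟨y, rfl⟩ := ((levelExact_toπ₀_tensor A B).exact₁ k x).1 hx
  obtain ⟨z, rfl⟩ := homologyMap_toπ₀_surjective A B (k + 1) y
  exact ((levelExact_toπ₀_tensor A B).exact₃ k).apply_apply_eq_zero z

/-- On homology `fromConst` factors through the components: a class that dies there comes from
edges, and the two ends of an edge induce the same map. -/
lemma homologyMap_fromConst_eq_zero (A B : SimplicialModule.{u}) (k : ℕ)
    {x : homology k (tensor (const (A _⦋0⦌)) B)}
    (hx : homologyMap k (tensorMap (constMap (π₀Mk A)) (𝟙 B)) x = 0) :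
    homologyMap k (tensorMap (fromConst A) (𝟙 B)) x = 0 := by
  have he : Function.Exact (A.δ (n := 0) 0 - A.δ 1).hom (π₀Mk A).hom :=
    π₀Mk_eq_zero_iff A
  obtain ⟨c, rfl⟩ := (homologyMap_constMap_exact k he B x).1 hx
  have e : constMap (A.δ (n := 0) 0 - A.δ 1) =
      constMap (A.δ (n := 0) 0) - constMap (A.δ (n := 0) 1) := rfl
  have h := homologyMap_vertex_eq A B k
  rw [← homologyMap_comp_apply, ← tensorMap_comp, Category.comp_id, e, Preadditive.sub_comp,
    tensorMap_sub_left, homologyMap_sub, h, sub_self]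
  rfl

/-- The long exact sequence breaks into short ones, split through `fromConst` naturally in `f` and
`g`. The splitting lifts a kernel class on components to a kernel class of `f ⊗ g`. -/
lemma rank_ker_eq_reduced_add (f : A ⟶ A') (g : B ⟶ B') (k : ℕ) :
    Module.rank ℚ (LinearMap.ker (homologyMap k (tensorMap f g))) =
      Module.rank ℚ (LinearMap.ker (homologyMap k (tensorMap (reducedMap f) g))) +
      Module.rank ℚ (LinearMap.ker (homologyMap k (tensorMap (constMap (π₀Map f)) g))) := by
  refine LinearMap.rank_ker_eq_add_of_exact (homologyMap_reduced_injective A B k)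
    ((levelExact_toπ₀_tensor A B).exact₂ k) (homologyMap_reduced_injective A' B' k)
    (p' := homologyMap k (tensorMap (toπ₀ A') (𝟙 B'))) ?_ ?_ fun y hy => ?_
  · rw [← homologyMap_comp, ← homologyMap_comp, ← tensorMap_comp, ← tensorMap_comp,
      reducedMap_comp_kerι, Category.id_comp, Category.comp_id]
  · rw [← homologyMap_comp, ← homologyMap_comp, ← tensorMap_comp, ← tensorMap_comp,
      toπ₀_comp_constMap, Category.id_comp, Category.comp_id]
  · obtain ⟨z, rfl⟩ := homologyMap_constMap_surjective k (π₀Mk_surjective A) B y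
    refine ⟨homologyMap k (tensorMap (fromConst A) (𝟙 B)) z, ?_, ?_⟩
    · rw [← homologyMap_comp_apply, ← tensorMap_comp, ← constMap_comp_fromConst,
        Category.id_comp, ← Category.comp_id g, tensorMap_comp, homologyMap_comp_apply]
      refine homologyMap_fromConst_eq_zero A' B' k ?_
      rw [← homologyMap_comp_apply, ← tensorMap_comp, Category.id_comp] at hy
      rw [← homologyMap_comp_apply, ← tensorMap_comp, Category.comp_id]
      exact hy
    · rw [← homologyMap_comp_apply, tensorMap_fromConst_comp_toπ₀]

/-! ### Delooping -/

lemma subsingleton_homology_zero_reduced (A B : SimplicialModule.{u}) :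
    Subsingleton (homology 0 (tensor (reduced A) B)) :=
  have := subsingleton_homology_path A B 0
  (levelExact_pathEnd_tensor A B).surjective_zero.subsingleton

/-- The connecting isomorphism of the path fibration. -/
def deloopEquiv (A B : SimplicialModule.{u}) (k : ℕ) :
    homology (k + 1) (tensor (reduced A) B) ≃ₗ[ℚ] homology k (tensor (loops A) B) :=
  LinearEquiv.ofBijective ((levelExact_pathEnd_tensor A B).δ k) <| by
    have h₁ := subsingleton_homology_path A B k
    have h₂ := subsingleton_homology_path A B (k + 1)
    constructor
    · refine (injective_iff_map_eq_zero _).2 fun x hx => ?_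
      obtain ⟨y, rfl⟩ := ((levelExact_pathEnd_tensor A B).exact₃ k x).1 hx
      rw [Subsingleton.elim y 0, map_zero]
    · exact fun x => ((levelExact_pathEnd_tensor A B).exact₁ k x).1 (Subsingleton.elim _ _)

lemma deloopEquiv_naturality (f : A ⟶ A') (g : B ⟶ B') (k : ℕ)
    (x : homology (k + 1) (tensor (reduced A) B)) :
    deloopEquiv A' B' k (homologyMap (k + 1) (tensorMap (reducedMap f) g) x) =
      homologyMap k (tensorMap (loopsMap f) g) (deloopEquiv A B k x) := by
  refine ((levelExact_pathEnd_tensor A B).δ_naturality (levelExact_pathEnd_tensor A' B')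
    (tensorMap (loopsMap f) g) (tensorMap (pathMap f) g) (tensorMap (reducedMap f) g)
    ?_ ?_ k x).symm
  · rw [← tensorMap_comp, ← tensorMap_comp, Category.id_comp, Category.comp_id]
    rfl
  · rw [← tensorMap_comp, ← tensorMap_comp, Category.id_comp, Category.comp_id,
      pathEnd_comp_reducedMap]

/-- The recursion behind the Künneth inequalities: the reduced part deloops to degree `k`, and the
components stay in degree `k + 1`. -/
lemma rank_ker_tensor_succ (f : A ⟶ A') (g : B ⟶ B') (k : ℕ) :
    Module.rank ℚ (LinearMap.ker (homologyMap (k + 1) (tensorMap f g))) =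
      Module.rank ℚ (LinearMap.ker (homologyMap k (tensorMap (loopsMap f) g))) +
      Module.rank ℚ (LinearMap.ker (homologyMap (k + 1) (tensorMap (constMap (π₀Map f)) g))) := by
  rw [rank_ker_eq_reduced_add]
  congr 1
  exact LinearMap.rank_ker_eq_of_equiv (deloopEquiv A B k) (deloopEquiv A' B' k)
    (deloopEquiv_naturality f g k)

lemma rank_ker_tensor_zero (f : A ⟶ A') (g : B ⟶ B') :
    Module.rank ℚ (LinearMap.ker (homologyMap 0 (tensorMap f g))) =
      Module.rank ℚ (LinearMap.ker (homologyMap 0 (tensorMap (constMap (π₀Map f)) g))) := by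
  have := subsingleton_homology_zero_reduced A B
  rw [rank_ker_eq_reduced_add, rank_subsingleton', zero_add]

/-! ### The unit -/

/-- The unit of the levelwise tensor product. -/
def unit : SimplicialModule.{u} := const (ModuleCat.of ℚ (ULift.{u} ℚ))

/-- The right unitor. -/
def rightUnitor (A : SimplicialModule.{u}) : tensor A unit ≅ A :=
  NatIso.ofComponents (fun n => ((TensorProduct.congr (LinearEquiv.refl ℚ (A.obj n))
    (ULift.moduleEquiv : ULift.{u} ℚ ≃ₗ[ℚ] ℚ)).trans (TensorProduct.rid ℚ (A.obj n))).toModuleIso)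
    fun {m n} θ => ModuleCat.hom_ext (TensorProduct.ext' fun a r => by
      exact (map_smul (A.map θ).hom r.down a).symm)

lemma rightUnitor_naturality (f : A ⟶ B) :
    tensorMap f (𝟙 unit) ≫ (rightUnitor B).hom = (rightUnitor A).hom ≫ f :=
  tensor_hom_ext fun n a r => (map_smul (f.app n).hom (r : ULift.{u} ℚ).down a).symm

lemma rank_ker_tensor_unit (f : A ⟶ B) (k : ℕ) :
    Module.rank ℚ (LinearMap.ker (homologyMap k (tensorMap f (𝟙 unit)))) =
      Module.rank ℚ (LinearMap.ker (homologyMap k f)) :=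
  LinearMap.rank_ker_eq_of_equiv (homologyEquiv k (rightUnitor A))
    (homologyEquiv k (rightUnitor B)) fun x =>
      (homologyMap_comp_apply k _ (rightUnitor B).hom x).symm.trans
        ((congrArg (fun φ => homologyMap k φ x) (rightUnitor_naturality f)).trans
          (homologyMap_comp_apply k (rightUnitor A).hom f x))

lemma subsingleton_homology_const (k : ℕ) (V : ModuleCat.{u} ℚ) :
    Subsingleton (homology (k + 1) (const V)) := by
  have h := ChainComplex.alternatingConst_exactAt V (k + 1) (by simp)
  have h' := h.of_iso (AlgebraicTopology.alternatingFaceMapComplexConst.app V).symm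
  exact ModuleCat.subsingleton_of_isZero h'.isZero_homology

/-- The homology of a constant simplicial module in degree zero. -/
def homologyZeroConstEquiv (V : ModuleCat.{u} ℚ) : homology 0 (const V) ≃ₗ[ℚ] V :=
  ((HomologicalComplex.homologyFunctor _ _ 0).mapIso
    (AlgebraicTopology.alternatingFaceMapComplexConst.app V) ≪≫
    ChainComplex.alternatingConstHomologyZero V).toLinearEquiv

lemma rank_ker_homology_zero (f : A ⟶ B) :
    Module.rank ℚ (LinearMap.ker (homologyMap 0 f)) =
      Module.rank ℚ (LinearMap.ker (π₀Map f).hom) := by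
  let N : ModuleCat.{u} ℚ := ModuleCat.of ℚ (LinearMap.ker (π₀Map f).hom)
  let ι : N ⟶ π₀ A := ModuleCat.ofHom (LinearMap.ker (π₀Map f).hom).subtype
  have he : Function.Exact ι.hom (π₀Map f).hom :=
    fun x => ⟨fun hx => ⟨⟨x, hx⟩, rfl⟩, by rintro ⟨y, rfl⟩; exact y.2⟩
  have h₁ := homologyMap_constMap_injective 0 (u := ι) Subtype.val_injective unit
  have h₂ := homologyMap_constMap_exact 0 he unit
  rw [← rank_ker_tensor_unit, rank_ker_tensor_zero]
  rw [(LinearMap.exact_iff.1 h₂), rank_range_of_injective _ h₁]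
  exact ((homologyEquiv 0 (rightUnitor (const N))).trans (homologyZeroConstEquiv N)).rank_eq

/-- This is the recursion with `B` the unit, where the component term vanishes because constant
modules have no homology in positive degree. -/
lemma rank_ker_homology_loops (f : A ⟶ B) (k : ℕ) :
    Module.rank ℚ (LinearMap.ker (homologyMap k (loopsMap f))) =
      Module.rank ℚ (LinearMap.ker (homologyMap (k + 1) f)) := by
  have h := subsingleton_homology_const k (π₀ A)
  have := (homologyEquiv (k + 1) (rightUnitor (const (π₀ A)))).toEquiv.subsingleton
  rw [← rank_ker_tensor_unit, ← rank_ker_tensor_unit (k := k + 1), rank_ker_tensor_succ,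
    rank_subsingleton' ℚ (LinearMap.ker (homologyMap (k + 1)
      (tensorMap (constMap (π₀Map f)) (𝟙 unit)))), add_zero]

/-- Statements about kernels, applied to the zero map, become statements about whole homology
groups. -/
lemma rank_homology_eq_rank_ker_zero (A B : SimplicialModule.{u}) (k : ℕ) :
    Module.rank ℚ (homology k A) = Module.rank ℚ (LinearMap.ker (homologyMap k (0 : A ⟶ B))) := by
  rw [homologyMap_zero, LinearMap.ker_zero, rank_top]

lemma rank_π₀ (A : SimplicialModule.{u}) :
    Module.rank ℚ (π₀ A) = Module.rank ℚ (homology 0 A) := by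
  have e : (π₀Map (0 : A ⟶ A)).hom = 0 := by
    refine LinearMap.ext fun x => ?_
    obtain ⟨v, rfl⟩ := π₀Mk_surjective A x
    exact map_zero (π₀Mk A).hom
  rw [rank_homology_eq_rank_ker_zero A A, rank_ker_homology_zero, e, LinearMap.ker_zero, rank_top]

lemma loopsMap_zero : loopsMap (0 : A ⟶ B) = 0 := by
  ext n x
  exact Subtype.ext (Subtype.ext rfl)

lemma constMap_π₀Map_zero : constMap (π₀Map (0 : A ⟶ B)) = 0 := by
  refine NatTrans.ext (funext fun n => ModuleCat.hom_ext (LinearMap.ext fun x => ?_))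
  obtain ⟨v, rfl⟩ := π₀Mk_surjective A x
  exact map_zero (π₀Mk B).hom

lemma rank_homology_loops (A : SimplicialModule.{u}) (k : ℕ) :
    Module.rank ℚ (homology k (loops A)) = Module.rank ℚ (homology (k + 1) A) := by
  rw [rank_homology_eq_rank_ker_zero _ (loops A), rank_homology_eq_rank_ker_zero A A,
    ← rank_ker_homology_loops, loopsMap_zero]

/-! ### The Künneth inequalities -/

/-- The kernel contains both `ker π₀(f) ⊗ H_k(B)` and `π₀(A) ⊗ ker H_k(g)`. The maximum of the two
ranks suffices later, and it avoids subtracting the overlap, which makes no sense for infinite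
cardinals. -/
lemma max_le_rank_ker_const_tensor (f : A ⟶ A') (g : B ⟶ B') (k : ℕ) :
    max (Module.rank ℚ (LinearMap.ker (homologyMap 0 f)) * Module.rank ℚ (homology k B))
      (Module.rank ℚ (homology 0 A) * Module.rank ℚ (LinearMap.ker (homologyMap k g))) ≤
      Module.rank ℚ (LinearMap.ker (homologyMap k (tensorMap (constMap (π₀Map f)) g))) := by
  refine max_le ?_ ?_
  · rw [rank_ker_homology_zero]
    let N : ModuleCat.{u} ℚ := ModuleCat.of ℚ (LinearMap.ker (π₀Map f).hom)
    let ι : N ⟶ π₀ A := ModuleCat.ofHom (LinearMap.ker (π₀Map f).hom).subtype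
    have h₁ := homologyMap_constMap_injective k (u := ι) Subtype.val_injective B
    refine (rank_mul_rank_homology_le k N B).trans ?_
    rw [← rank_range_of_injective _ h₁]
    refine Submodule.rank_mono ?_
    rintro _ ⟨x, rfl⟩
    have e : constMap ι ≫ constMap (π₀Map f) = 0 :=
      NatTrans.ext (funext fun n => ModuleCat.hom_ext (LinearMap.ext fun x => x.2))
    rw [LinearMap.mem_ker, ← homologyMap_comp_apply, ← tensorMap_comp, e, tensorMap_zero_left,
      homologyMap_zero]
    rfl
  · rw [← rank_π₀]
    refine (rank_mul_rank_ker_le k (π₀ A) g).trans (Submodule.rank_mono fun x hx => ?_)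
    have e : tensorMap (constMap (π₀Map f)) g =
        tensorMap (𝟙 _) g ≫ tensorMap (constMap (π₀Map f)) (𝟙 _) := by
      rw [← tensorMap_comp, Category.comp_id, Category.id_comp]
    rw [LinearMap.mem_ker, e, homologyMap_comp_apply, LinearMap.mem_ker.1 hx, map_zero]

/-- A lower bound for the kernel of a tensor product of maps on homology. -/
theorem sum_max_le_rank_ker_tensor (f : A ⟶ A') (g : B ⟶ B') (k : ℕ) :
    ∑ p ∈ Finset.HasAntidiagonal.antidiagonal k,
      max (Module.rank ℚ (LinearMap.ker (homologyMap p.1 f)) * Module.rank ℚ (homology p.2 B))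
        (Module.rank ℚ (homology p.1 A) * Module.rank ℚ (LinearMap.ker (homologyMap p.2 g))) ≤
      Module.rank ℚ (LinearMap.ker (homologyMap k (tensorMap f g))) := by
  induction k generalizing A A' with
  | zero =>
    rw [Finset.Nat.antidiagonal_zero, Finset.sum_singleton, rank_ker_tensor_zero]
    exact max_le_rank_ker_const_tensor f g 0
  | succ k ih =>
    -- The term `(0, k + 1)` is carried by the components; the terms `(p + 1, q)` are the terms `(p,
    -- q)` for `loopsMap f`.
    rw [Finset.Nat.sum_antidiagonal_succ, rank_ker_tensor_succ, add_comm]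
    refine add_le_add ?_ (max_le_rank_ker_const_tensor f g (k + 1))
    refine le_trans (le_of_eq ?_) (ih (loopsMap f))
    refine Finset.sum_congr rfl fun p _ => ?_
    rw [rank_ker_homology_loops, rank_homology_loops]

/-- An upper bound for the homology of a tensor product. -/
theorem rank_homology_tensor_le (A B : SimplicialModule.{u})
    (hA : ∀ i, Module.rank ℚ (homology i A) < Cardinal.aleph0) (k : ℕ) :
    Module.rank ℚ (homology k (tensor A B)) ≤ ∑ p ∈ Finset.HasAntidiagonal.antidiagonal k,
      Module.rank ℚ (homology p.1 A) * Module.rank ℚ (homology p.2 B) := by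
  have key (A : SimplicialModule.{u}) (hA : Module.rank ℚ (homology 0 A) < Cardinal.aleph0)
      (k : ℕ) : Module.rank ℚ (homology k (tensor (const (π₀ A)) B)) ≤
      Module.rank ℚ (homology 0 A) * Module.rank ℚ (homology k B) := by
    rw [← rank_π₀] at hA ⊢
    have : Module.Finite ℚ (π₀ A) := Module.rank_lt_aleph0_iff.1 hA
    exact rank_homology_const_tensor_le k (π₀ A) B
  induction k generalizing A with
  | zero =>
    rw [Finset.Nat.antidiagonal_zero, Finset.sum_singleton]
    refine le_trans (le_of_eq ?_) (key A (hA 0) 0)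
    rw [rank_homology_eq_rank_ker_zero _ (tensor A B), ← tensorMap_zero_left (𝟙 B),
      rank_ker_tensor_zero, constMap_π₀Map_zero, tensorMap_zero_left,
      ← rank_homology_eq_rank_ker_zero]
  | succ k ih =>
    have e : Module.rank ℚ (homology (k + 1) (tensor A B)) =
        Module.rank ℚ (homology k (tensor (loops A) B)) +
          Module.rank ℚ (homology (k + 1) (tensor (const (π₀ A)) B)) := by
      rw [rank_homology_eq_rank_ker_zero _ (tensor A B), ← tensorMap_zero_left (𝟙 B),
        rank_ker_tensor_succ, constMap_π₀Map_zero, tensorMap_zero_left,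
        ← rank_homology_eq_rank_ker_zero, loopsMap_zero, tensorMap_zero_left,
        ← rank_homology_eq_rank_ker_zero]
    rw [Finset.Nat.sum_antidiagonal_succ, e, add_comm]
    refine add_le_add (key A (hA 0) (k + 1)) ?_
    refine (ih (loops A) fun i => ?_).trans (le_of_eq (Finset.sum_congr rfl fun p _ => ?_))
    · rw [rank_homology_loops]; exact hA (i + 1)
    · rw [rank_homology_loops]

end SimplicialModule

namespace SimplicialModule

/-! ### Free modules -/

/-- The free rational vector space on a type, as a coproduct. -/
abbrev free : Type u ⥤ ModuleCat.{u} ℚ :=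
  Limits.sigmaConst.obj (ModuleCat.of ℚ (ULift.{u} ℚ))

/-- The basis vector of the free vector space. -/
def freeSingle {J : Type u} (j : J) : free.obj J :=
  (Limits.Sigma.ι (fun _ : J => ModuleCat.of ℚ (ULift.{u} ℚ)) j).hom ⟨1⟩

lemma free_map_freeSingle {I J : Type u} (h : I ⟶ J) (i : I) :
    (free.map h).hom (freeSingle i) = freeSingle (h i) := by
  have e := Limits.Sigma.ι_comp_map' (f := fun _ : I => ModuleCat.of ℚ (ULift.{u} ℚ))
    (g := fun _ : J => ModuleCat.of ℚ (ULift.{u} ℚ)) h (fun _ => 𝟙 _) i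
  rw [Category.id_comp] at e
  exact congrArg (fun φ => φ.hom (ULift.up 1)) e

lemma free_hom_ext {J : Type u} {M : Type u} [AddCommGroup M] [Module ℚ M]
    {f g : free.obj J →ₗ[ℚ] M} (h : ∀ j, f (freeSingle j) = g (freeSingle j)) : f = g := by
  have e : ModuleCat.ofHom f = ModuleCat.ofHom g :=
    Limits.Sigma.hom_ext _ _ fun j => ModuleCat.hom_ext <| LinearMap.ext fun r => by
      have hr : r = r.down • ULift.up 1 := ULift.ext _ _ (mul_one r.down).symm
      rw [hr, map_smul, map_smul]
      exact congrArg (r.down • ·) (h j)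
  exact congrArg ModuleCat.Hom.hom e

/-- The coordinates of an element of the free vector space. -/
def freeToFinsupp (J : Type u) : free.obj J →ₗ[ℚ] (J →₀ ℚ) :=
  (Limits.Sigma.desc (f := fun _ : J => ModuleCat.of ℚ (ULift.{u} ℚ)) fun j =>
    ModuleCat.ofHom (Y := J →₀ ℚ) (Finsupp.lsingle j ∘ₗ ULift.moduleEquiv.toLinearMap)).hom

lemma freeToFinsupp_freeSingle {J : Type u} (j : J) :
    freeToFinsupp J (freeSingle j) = Finsupp.single j 1 :=
  congrArg (fun φ => φ.hom (ULift.up 1)) (Limits.Sigma.ι_desc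
    (f := fun _ : J => ModuleCat.of ℚ (ULift.{u} ℚ)) (fun j =>
    ModuleCat.ofHom (Y := J →₀ ℚ) (Finsupp.lsingle j ∘ₗ ULift.moduleEquiv.toLinearMap)) j)

/-- The free vector space as finitely supported functions. -/
def freeEquiv (J : Type u) : free.obj J ≃ₗ[ℚ] (J →₀ ℚ) :=
  LinearEquiv.ofLinearMap (freeToFinsupp J)
    (Finsupp.lsum ℚ fun j => LinearMap.toSpanSingleton ℚ (free.obj J) (freeSingle j))
    (Finsupp.lhom_ext' fun j => LinearMap.ext_ring (by
      simp only [LinearMap.comp_apply, Finsupp.lsingle_apply, Finsupp.lsum_single,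
        LinearMap.toSpanSingleton_apply, one_smul, LinearMap.id_apply]
      exact freeToFinsupp_freeSingle j))
    (free_hom_ext fun j => by
      rw [LinearMap.comp_apply, freeToFinsupp_freeSingle, Finsupp.lsum_single,
        LinearMap.toSpanSingleton_apply, one_smul, LinearMap.id_apply])

lemma freeEquiv_freeSingle {J : Type u} (j : J) :
    freeEquiv J (freeSingle j) = Finsupp.single j 1 :=
  freeToFinsupp_freeSingle j

lemma freeEquiv_symm_single {J : Type u} (j : J) :
    (freeEquiv J).symm (Finsupp.single j 1) = freeSingle j := by
  rw [← freeEquiv_freeSingle, LinearEquiv.symm_apply_apply]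

/-- The free vector space on a product is the tensor product. -/
def freeTensorEquiv {I J K : Type u} (h : K ≃ I × J) :
    free.obj K ≃ₗ[ℚ] free.obj I ⊗[ℚ] free.obj J :=
  (freeEquiv K).trans <| (Finsupp.domLCongr h).trans <| (finsuppTensorFinsupp' ℚ I J).symm.trans
    (TensorProduct.congr (freeEquiv I).symm (freeEquiv J).symm)

lemma freeTensorEquiv_freeSingle {I J K : Type u} (h : K ≃ I × J) (k : K) :
    freeTensorEquiv h (freeSingle k) = freeSingle (h k).1 ⊗ₜ freeSingle (h k).2 := by
  rw [freeTensorEquiv, LinearEquiv.trans_apply, freeEquiv_freeSingle, LinearEquiv.trans_apply,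
    Finsupp.domLCongr_single, LinearEquiv.trans_apply, finsuppTensorFinsupp'_symm_single_eq_tmul_single_one,
    TensorProduct.congr_tmul, freeEquiv_symm_single, freeEquiv_symm_single]

/-! ### Singular chains -/

variable {X X' Y Y' Z Z' : Type u} [TopologicalSpace X] [TopologicalSpace X'] [TopologicalSpace Y]
  [TopologicalSpace Y'] [TopologicalSpace Z] [TopologicalSpace Z']

/-- The simplicial module of rational singular chains. -/
def singular (X : Type u) [TopologicalSpace X] : SimplicialModule.{u} :=
  ((SimplicialObject.whiskering _ _).obj free).obj (TopCat.toSSet.obj (TopCat.of X))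

/-- The map induced on singular chains. -/
def singularMap (f : C(X, Y)) : singular X ⟶ singular Y :=
  ((SimplicialObject.whiskering _ _).obj free).map (TopCat.toSSet.map (TopCat.ofHom f))

/-- Singular simplices of a product. -/
def singularSimplexEquiv (e : Z ≃ₜ X × Y) (n : SimplexCategoryᵒᵖ) :
    (TopCat.toSSet.obj (TopCat.of Z)).obj n ≃
      (TopCat.toSSet.obj (TopCat.of X)).obj n × (TopCat.toSSet.obj (TopCat.of Y)).obj n where
  toFun s := ((TopCat.toSSet.map (TopCat.ofHom (ContinuousMap.fst.comp (e : C(Z, X × Y))))).app n s,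
    (TopCat.toSSet.map (TopCat.ofHom (ContinuousMap.snd.comp (e : C(Z, X × Y))))).app n s)
  invFun s := ⟨TopCat.ofHom ((e.symm : C(X × Y, Z)).comp (s.1.down.hom.prodMk s.2.down.hom))⟩
  left_inv s := by
    refine ULift.ext _ _ (ConcreteCategory.hom_ext _ _ fun t => ?_)
    exact e.symm_apply_apply _
  right_inv s := by
    refine Prod.ext ?_ ?_ <;>
      refine ULift.ext _ _ (ConcreteCategory.hom_ext _ _ fun t => ?_)
    · exact congrArg Prod.fst (e.apply_symm_apply (s.1.down.hom t, s.2.down.hom t))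
    · exact congrArg Prod.snd (e.apply_symm_apply (s.1.down.hom t, s.2.down.hom t))

lemma singular_map_freeSingle {m n : SimplexCategoryᵒᵖ} (θ : m ⟶ n)
    (s : (TopCat.toSSet.obj (TopCat.of X)).obj m) :
    ((singular X).map θ).hom (freeSingle s) =
      freeSingle ((TopCat.toSSet.obj (TopCat.of X)).map θ s) :=
  free_map_freeSingle _ _

lemma singularMap_freeSingle (f : C(X, Y)) (n : SimplexCategoryᵒᵖ)
    (s : (TopCat.toSSet.obj (TopCat.of X)).obj n) :
    ((singularMap f).app n).hom (freeSingle s) =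
      freeSingle ((TopCat.toSSet.map (TopCat.ofHom f)).app n s) :=
  free_map_freeSingle _ _

/-- Singular chains on a product. -/
def singularProdIso (e : Z ≃ₜ X × Y) : singular Z ≅ tensor (singular X) (singular Y) :=
  NatIso.ofComponents (fun n => (freeTensorEquiv (singularSimplexEquiv e n)).toModuleIso)
    fun {m n} θ => ModuleCat.hom_ext <| free_hom_ext fun s => by
      change freeTensorEquiv (singularSimplexEquiv e n) (((singular Z).map θ).hom (freeSingle s)) =
        ((tensor (singular X) (singular Y)).map θ).hom
          (freeTensorEquiv (singularSimplexEquiv e m) (freeSingle s))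
      rw [singular_map_freeSingle, freeTensorEquiv_freeSingle, freeTensorEquiv_freeSingle]
      change _ = ((singular X).map θ).hom _ ⊗ₜ[ℚ] ((singular Y).map θ).hom _
      rw [singular_map_freeSingle, singular_map_freeSingle]
      rfl

lemma singularProdIso_naturality (e : Z ≃ₜ X × Y) (e' : Z' ≃ₜ X' × Y') (h : C(Z, Z'))
    (f : C(X, X')) (g : C(Y, Y')) (w : ∀ z, e' (h z) = (f (e z).1, g (e z).2)) :
    singularMap h ≫ (singularProdIso e').hom =
      (singularProdIso e).hom ≫ tensorMap (singularMap f) (singularMap g) := by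
  refine NatTrans.ext (funext fun n => ModuleCat.hom_ext <| free_hom_ext fun s => ?_)
  change freeTensorEquiv (singularSimplexEquiv e' n) (((singularMap h).app n).hom (freeSingle s)) =
    ((tensorMap (singularMap f) (singularMap g)).app n).hom
      (freeTensorEquiv (singularSimplexEquiv e n) (freeSingle s))
  rw [singularMap_freeSingle, freeTensorEquiv_freeSingle, freeTensorEquiv_freeSingle]
  change _ = ((singularMap f).app n).hom _ ⊗ₜ[ℚ] ((singularMap g).app n).hom _
  rw [singularMap_freeSingle, singularMap_freeSingle]
  congr 2 <;>
    refine ULift.ext _ _ (ConcreteCategory.hom_ext _ _ fun t => ?_)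
  · exact congrArg Prod.fst (w _)
  · exact congrArg Prod.snd (w _)

lemma rank_homology_singular_prod (e : Z ≃ₜ X × Y) (k : ℕ) :
    Module.rank ℚ (homology k (singular Z)) =
      Module.rank ℚ (homology k (tensor (singular X) (singular Y))) :=
  (homologyEquiv k (singularProdIso e)).rank_eq

lemma rank_ker_homologyMap_singular_prod (e : Z ≃ₜ X × Y) (e' : Z' ≃ₜ X' × Y') (h : C(Z, Z'))
    (f : C(X, X')) (g : C(Y, Y')) (w : ∀ z, e' (h z) = (f (e z).1, g (e z).2)) (k : ℕ) :
    Module.rank ℚ (LinearMap.ker (homologyMap k (singularMap h))) =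
      Module.rank ℚ (LinearMap.ker (homologyMap k (tensorMap (singularMap f) (singularMap g)))) :=
  LinearMap.rank_ker_eq_of_equiv (homologyEquiv k (singularProdIso e))
    (homologyEquiv k (singularProdIso e')) fun x =>
      (homologyMap_comp_apply k _ (singularProdIso e').hom x).symm.trans
        ((congrArg (fun φ => homologyMap k φ x) (singularProdIso_naturality e e' h f g w)).trans
          (homologyMap_comp_apply k (singularProdIso e).hom _ x))

end SimplicialModule

end

/-! ### Coefficients of Poincaré polynomials -/

/-- Finite support matters: otherwise `∑ᶠ` takes the default value zero. -/
lemma Polynomial.coeff_finsum_monomial_add_two (c : ℕ → ℕ) (hc : c.support.Finite) (m : ℕ) :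
    (∑ᶠ k, Polynomial.monomial (k + 2) (c k)).coeff m = if 2 ≤ m then c (m - 2) else 0 := by
  have hs : (fun k => Polynomial.monomial (k + 2) (c k)).support ⊆ hc.toFinset := fun k hk => by
    refine hc.mem_toFinset.2 fun h => hk ?_
    change Polynomial.monomial (k + 2) (c k) = 0
    rw [h, map_zero]
  rw [finsum_eq_sum_of_support_subset _ hs, Polynomial.finsetSum_coeff]
  simp only [Polynomial.coeff_monomial]
  split_ifs with h
  · rw [Finset.sum_eq_single (m - 2), if_pos (by omega)]
    · intro b _ hb
      exact if_neg (by omega)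
    · intro hm
      rw [if_pos (by omega)]
      exact not_not.1 fun h => hm (hc.mem_toFinset.2 h)
  · exact Finset.sum_eq_zero fun b _ => if_neg (by omega)

lemma Polynomial.aeval_mono_of_coeff_le {p q : Polynomial ℕ} (h : ∀ k, p.coeff k ≤ q.coeff k)
    {t : ℝ} (ht : 0 ≤ t) : Polynomial.aeval t p ≤ Polynomial.aeval t q := by
  have hp := Polynomial.aeval_eq_sum_range' (p := p) (n := max p.natDegree q.natDegree + 1)
    (by omega) t
  have hq := Polynomial.aeval_eq_sum_range' (p := q) (n := max p.natDegree q.natDegree + 1)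
    (by omega) t
  rw [hp, hq]
  exact Finset.sum_le_sum fun i _ => nsmul_le_nsmul_left (pow_nonneg ht i) (h i)

/-! ### Homological Poincaré polynomials of products and powers -/

namespace MapPoincare

lemma nontrivial_iff_rank_pos (V : ModuleCat.{u} ℚ) : Nontrivial V ↔ 0 < Module.rank ℚ V :=
  rank_pos_iff_nontrivial.symm

open SimplicialModule

variable {X X' Y Y' Z Z' : Type u} [TopologicalSpace X] [TopologicalSpace X'] [TopologicalSpace Y]
  [TopologicalSpace Y'] [TopologicalSpace Z] [TopologicalSpace Z']

lemma FiniteTotalDim.support_finrank {V : ℕ → Type u} [∀ i, AddCommGroup (V i)]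
    [∀ i, Module ℚ (V i)] (h : FiniteTotalDim V) :
    (fun i => Module.finrank ℚ (V i)).support.Finite :=
  h.2.subset fun _ hi => Module.nontrivial_of_finrank_pos (Nat.pos_of_ne_zero hi)

lemma FiniteTotalDim.ker {V W : ℕ → Type u} [∀ i, AddCommGroup (V i)] [∀ i, Module ℚ (V i)]
    [∀ i, AddCommGroup (W i)] [∀ i, Module ℚ (W i)] (h : FiniteTotalDim V)
    (φ : ∀ i, V i →ₗ[ℚ] W i) : FiniteTotalDim fun i => LinearMap.ker (φ i) := by
  refine ⟨fun i => ?_, h.2.subset fun i (hi : Nontrivial _) => ?_⟩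
  · have := h.1 i
    infer_instance
  · exact Function.Injective.nontrivial (Subtype.val_injective (p := (· ∈ LinearMap.ker (φ i))))

lemma coeff_homologicalPoincare {f : C(X, Y)}
    (hf : FiniteTotalDim fun i => LinearMap.ker (ratHomologyMap i f)) (k : ℕ) :
    (homologicalPoincare f).coeff k = if k = 0 then 1 else if k = 1 then 0 else
      Module.finrank ℚ (LinearMap.ker (ratHomologyMap k f)) := by
  have hs : (fun k => Module.finrank ℚ
      (LinearMap.ker (ratHomologyMap (k + 2) f))).support.Finite :=
    hf.support_finrank.preimage (f := (· + 2)) (fun _ _ _ _ h => Nat.add_right_cancel h)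
  rw [homologicalPoincare, Polynomial.coeff_add, Polynomial.coeff_finsum_monomial_add_two _ hs,
    Polynomial.coeff_one]
  match k with
  | 0 => rfl
  | 1 => rfl
  | k + 2 =>
    rw [if_neg (by omega), if_pos (by omega), if_neg (by omega), if_neg (by omega), zero_add]
    rfl

lemma coeff_homotopicalPoincare {f : C(X, Y)} {x : X}
    (hf : FiniteTotalDim fun i => LinearMap.ker (ratHomotopyMap i f x)) (k : ℕ) :
    (homotopicalPoincare f x).coeff k = if 2 ≤ k then
      Module.finrank ℚ (LinearMap.ker (ratHomotopyMap (k - 2) f x)) else 0 :=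
  Polynomial.coeff_finsum_monomial_add_two _ hf.support_finrank k

lemma rank_homology_zero [PathConnectedSpace X] :
    Module.rank ℚ (homology 0 (singular X)) = 1 := by
  have e : RatHomology 0 X ≅ ModuleCat.of ℚ (ULift.{u} ℚ) :=
    asIso ((TopCat.of X).singularHomology₀ε (ModuleCat.of ℚ (ULift.{u} ℚ)))
  rw [show Module.rank ℚ (homology 0 (singular X)) = Module.rank ℚ (ULift.{u} ℚ) from
    e.toLinearEquiv.rank_eq]
  rw [rank_ulift, Module.rank_self, Cardinal.lift_one]

/-- `homology i (singular X)` and `RatHomology i X` agree by definition, which is why `free` is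
built as a coproduct. -/
lemma FiniteHomologyRank.rank_lt (hX : FiniteHomologyRank X) (i : ℕ) :
    Module.rank ℚ (homology i (singular X)) < Cardinal.aleph0 :=
  Module.rank_lt_aleph0_iff.2 (hX.1 i)

lemma finiteHomologyRank_of_subsingleton [Subsingleton X] [Nonempty X] :
    FiniteHomologyRank X := by
  have : PathConnectedSpace X :=
    ⟨inferInstance, fun x y => Subsingleton.elim x y ▸ Joined.refl x⟩
  have key (i : ℕ) (hi : i ≠ 0) : Subsingleton (RatHomology i X) :=
    ModuleCat.subsingleton_of_isZero
      (AlgebraicTopology.isZero_singularHomologyFunctor_of_totallyDisconnectedSpace _ i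
        (ModuleCat.of ℚ (ULift.{u} ℚ)) (TopCat.of X) hi)
  refine ⟨fun i => ?_, (Set.finite_singleton 0).subset fun i hi => ?_⟩
  · by_cases hi : i = 0
    · subst hi
      exact Module.rank_lt_aleph0_iff.1 (rank_homology_zero.trans_lt Cardinal.one_lt_aleph0)
    · have := key i hi
      infer_instance
  · by_contra h
    exact not_subsingleton_iff_nontrivial.2 hi (key i h)

lemma FiniteHomologyRank.prod (hX : FiniteHomologyRank X) (hY : FiniteHomologyRank Y)
    (e : Z ≃ₜ X × Y) : FiniteHomologyRank Z := by
  have key (k : ℕ) := (rank_homology_singular_prod e k).trans_le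
    (rank_homology_tensor_le (singular X) (singular Y) hX.rank_lt k)
  refine ⟨fun k => ?_, ?_⟩
  · refine Module.rank_lt_aleph0_iff.1 ((key k).trans_lt ?_)
    refine Finset.sum_induction _ (· < Cardinal.aleph0) (fun _ _ => Cardinal.add_lt_aleph0)
      Cardinal.aleph0_pos fun p _ => Cardinal.mul_lt_aleph0 (hX.rank_lt _) (hY.rank_lt _)
  -- Nonzero homology in degree `k` forces a nonzero term in the upper bound, so `k` is a sum of two
  -- degrees taken from finite sets.
  · refine ((hX.2.prod hY.2).image fun p => p.1 + p.2).subset fun k hk => ?_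
    have h := ((nontrivial_iff_rank_pos (homology k (singular Z))).1 hk).trans_le (key k)
    obtain ⟨p, hp, hne⟩ := Finset.exists_ne_zero_of_sum_ne_zero h.ne'
    exact ⟨p, ⟨(nontrivial_iff_rank_pos _).2 (pos_of_ne_zero (left_ne_zero_of_mul hne)),
      (nontrivial_iff_rank_pos _).2 (pos_of_ne_zero (right_ne_zero_of_mul hne))⟩,
      Finset.HasAntidiagonal.mem_antidiagonal.1 hp⟩

/-- Equality holds from degree two on, and the coefficient in degree one is zero by convention.
Degree zero is excluded: its coefficient is 1 even when `H_0(f)` is injective. -/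
lemma coeff_homologicalPoincare_le_rank_ker {f : C(X, Y)}
    (hf : FiniteTotalDim fun i => LinearMap.ker (ratHomologyMap i f)) {k : ℕ} (hk : k ≠ 0) :
    ((homologicalPoincare f).coeff k : Cardinal.{u}) ≤
      Module.rank ℚ (LinearMap.ker (homologyMap k (singularMap f))) := by
  have := hf.1 k
  rw [coeff_homologicalPoincare hf, if_neg hk]
  split_ifs
  · exact Nat.cast_zero.trans_le zero_le
  · exact (Module.finrank_eq_rank ℚ (LinearMap.ker (ratHomologyMap k f))).le

lemma coeff_mul_homologicalPoincare_le [PathConnectedSpace X] [PathConnectedSpace Y]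
    (hX : FiniteHomologyRank X) (hY : FiniteHomologyRank Y) (e : Z ≃ₜ X × Y) (e' : Z' ≃ₜ X' × Y')
    (h : C(Z, Z')) (f : C(X, X')) (g : C(Y, Y')) (w : ∀ z, e' (h z) = (f (e z).1, g (e z).2))
    (k : ℕ) : (homologicalPoincare f * homologicalPoincare g).coeff k ≤
      (homologicalPoincare h).coeff k := by
  have hf := FiniteTotalDim.ker hX fun i => ratHomologyMap i f
  have hg := FiniteTotalDim.ker hY fun i => ratHomologyMap i g
  have hh := FiniteTotalDim.ker (hX.prod hY e) fun i => ratHomologyMap i h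
  match k with
  | 0 => simp [Polynomial.mul_coeff_zero, coeff_homologicalPoincare, hf, hg, hh]
  | 1 => simp [Polynomial.mul_coeff_one, coeff_homologicalPoincare, hf, hg, hh]
  | k + 2 =>
  have := hh.1 (k + 2)
  rw [coeff_homologicalPoincare hh, if_neg (by omega), if_neg (by omega), Polynomial.coeff_mul,
    ← Nat.cast_le (α := Cardinal.{u}), Module.finrank_eq_rank, Nat.cast_sum]
  refine le_of_le_of_eq ((Finset.sum_le_sum fun p hp => ?_).trans (sum_max_le_rank_ker_tensor
    (singularMap f) (singularMap g) (k + 2)))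
    (rank_ker_homologyMap_singular_prod e e' h f g w (k + 2)).symm
  rw [Nat.cast_mul]
  -- If `p.1 = 0`, the coefficient 1 is the dimension of `H_0` and the second entry of the maximum
  -- applies. Otherwise the first applies, and the other coefficient is bounded by a full homology
  -- group.
  by_cases h₁ : p.1 = 0
  · have h₂ : p.2 ≠ 0 := by have := Finset.HasAntidiagonal.mem_antidiagonal.1 hp; omega
    refine le_trans (mul_le_mul' ?_ (coeff_homologicalPoincare_le_rank_ker hg h₂))
      (le_max_right _ _)
    rw [h₁, coeff_homologicalPoincare hf, if_pos rfl, rank_homology_zero, Nat.cast_one]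
  · refine le_trans (mul_le_mul' (coeff_homologicalPoincare_le_rank_ker hf h₁) ?_)
      (le_max_left _ _)
    by_cases h₂ : p.2 = 0
    · rw [h₂, coeff_homologicalPoincare hg, if_pos rfl, rank_homology_zero, Nat.cast_one]
    · exact (coeff_homologicalPoincare_le_rank_ker hg h₂).trans (Submodule.rank_le _)

/-- A power splits off its first factor. -/
def powSuccHomeomorph (n : ℕ) (X : Type u) [TopologicalSpace X] :
    (Fin (n + 1) → X) ≃ₜ X × (Fin n → X) where
  toFun z := (z 0, Fin.tail z)
  invFun p := Fin.cons p.1 p.2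
  left_inv z := Fin.cons_self_tail z
  right_inv p := rfl
  continuous_toFun := (continuous_apply 0).prodMk (continuous_pi fun i => continuous_apply i.succ)
  continuous_invFun := continuous_pi fun i => by
    induction i using Fin.cases with
    | zero => exact continuous_fst
    | succ i => exact (continuous_apply i).comp continuous_snd

lemma FiniteHomologyRank.pow (hX : FiniteHomologyRank X) (n : ℕ) :
    FiniteHomologyRank (Fin n → X) := by
  induction n with
  | zero => exact finiteHomologyRank_of_subsingleton
  | succ n ih => exact hX.prod ih (powSuccHomeomorph n X)

lemma coeff_homologicalPoincare_pow_le [PathConnectedSpace X] (hX : FiniteHomologyRank X)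
    (f : C(X, Y)) (n k : ℕ) : (homologicalPoincare f ^ n).coeff k ≤
      (homologicalPoincare (power n f)).coeff k := by
  induction n generalizing k with
  | zero =>
    rw [pow_zero, homologicalPoincare, Polynomial.coeff_add]
    exact Nat.le_add_right _ _
  | succ n ih =>
    rw [pow_succ']
    refine le_trans ?_ (coeff_mul_homologicalPoincare_le hX (hX.pow n) (powSuccHomeomorph n X)
      (powSuccHomeomorph n Y) (power (n + 1) f) f (power n f) (fun z => rfl) k)
    rw [Polynomial.coeff_mul, Polynomial.coeff_mul]
    exact Finset.sum_le_sum fun p _ => Nat.mul_le_mul_left _ (ih p.2)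

lemma aeval_homologicalPoincare_pow_le [PathConnectedSpace X] (hX : FiniteHomologyRank X)
    (f : C(X, Y)) (n : ℕ) {t : ℝ} (ht : 0 ≤ t) :
    Polynomial.aeval t (homologicalPoincare f) ^ n ≤
      Polynomial.aeval t (homologicalPoincare (power n f)) := by
  rw [← map_pow]
  exact Polynomial.aeval_mono_of_coeff_le (coeff_homologicalPoincare_pow_le hX f n) ht

end MapPoincare

/-! ### Transport of loops along paths of base points -/

section

open scoped unitInterval

namespace GenLoop

variable {N : Type} {S : Type*} [TopologicalSpace S] {X Y : Type u}
  [TopologicalSpace X] [TopologicalSpace Y] {x z : X}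

/-! ### Free homotopies -/

lemma homotopic_of_forall {p q : GenLoop N X x} (H : C(I × (I^N), X)) (h₀ : ∀ t, H (0, t) = p t)
    (h₁ : ∀ t, H (1, t) = q t) (h : ∀ s, ∀ t ∈ Cube.boundary N, H (s, t) = x) :
    Homotopic p q :=
  ⟨⟨⟨H, h₀, h₁⟩, fun s t ht => (h s t ht).trans (p.2 t ht).symm⟩⟩

/-- Free homotopies of loops along a path of base points. -/
def HomotopicAlong (γ : Path x z) (p : GenLoop N X x) (q : GenLoop N X z) : Prop :=
  ∃ H : C(I × (I^N), X), (∀ t, H (0, t) = p t) ∧ (∀ t, H (1, t) = q t) ∧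
    ∀ s, ∀ t ∈ Cube.boundary N, H (s, t) = γ s

lemma HomotopicAlong.symm {γ : Path x z} {p : GenLoop N X x} {q : GenLoop N X z}
    (h : HomotopicAlong γ p q) : HomotopicAlong γ.symm q p := by
  obtain ⟨H, h₀, h₁, hb⟩ := h
  refine ⟨H.comp ⟨fun y => (σ y.1, y.2), by fun_prop⟩, fun t => ?_, fun t => ?_, fun s t ht => ?_⟩
  · change H (σ 0, t) = _
    rw [unitInterval.symm_zero, h₁]
  · change H (σ 1, t) = _
    rw [unitInterval.symm_one, h₀]
  · exact hb _ t ht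

lemma update_mem_boundary [DecidableEq N] {t : I^N} {i : N} {a : I}
    (h : (t i = 0 ∨ t i = 1) → a = 0 ∨ a = 1) (ht : t ∈ Cube.boundary N) :
    Function.update t i a ∈ Cube.boundary N := by
  obtain ⟨j, hj⟩ := ht
  by_cases hji : j = i
  · subst hji
    exact ⟨j, by rw [Function.update_self]; exact h hj⟩
  · exact ⟨j, by rw [Function.update_of_ne hji]; exact hj⟩

lemma HomotopicAlong.transAt [DecidableEq N] {γ : Path x z} {p p' : GenLoop N X x}
    {q q' : GenLoop N X z} (i : N) (h : HomotopicAlong γ p q) (h' : HomotopicAlong γ p' q') :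
    HomotopicAlong γ (transAt i p p') (transAt i q q') := by
  obtain ⟨H, h₀, h₁, hb⟩ := h
  obtain ⟨H', h₀', h₁', hb'⟩ := h'
  have hc (f : ℝ → ℝ) (hf : Continuous f) : Continuous fun y : I × (I^N) =>
      (y.1, Function.update y.2 i (Set.projIcc 0 1 zero_le_one (f (y.2 i)))) :=
    continuous_fst.prodMk (continuous_snd.update i (continuous_projIcc.comp (by fun_prop)))
  refine ⟨⟨fun y => if (y.2 i : ℝ) ≤ 1 / 2
      then H (y.1, Function.update y.2 i (Set.projIcc 0 1 zero_le_one (2 * y.2 i)))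
      else H' (y.1, Function.update y.2 i (Set.projIcc 0 1 zero_le_one (2 * y.2 i - 1))),
      Continuous.if_le (H.continuous.comp (hc (fun r => 2 * r) (by fun_prop)))
        (H'.continuous.comp (hc (fun r => 2 * r - 1) (by fun_prop))) (by fun_prop)
        continuous_const fun y hy => ?_⟩, fun t => ?_, fun t => ?_, fun s t ht => ?_⟩
  -- On the common face both homotopies follow `γ`, so they glue.
  · refine (hb _ _ ⟨i, Or.inr ?_⟩).trans (hb' _ _ ⟨i, Or.inl ?_⟩).symm
    · rw [Function.update_self, hy]
      exact Set.projIcc_of_right_le zero_le_one (by norm_num)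
    · rw [Function.update_self, hy]
      exact Set.projIcc_of_le_left zero_le_one (by norm_num)
  · exact congrArg₂ (ite _) (h₀ _) (h₀' _)
  · exact congrArg₂ (ite _) (h₁ _) (h₁' _)
  · change ite ((t i : ℝ) ≤ 1 / 2) (H (s, _)) (H' (s, _)) = _
    split_ifs with hi
    · refine hb _ _ (update_mem_boundary (fun (h : t i = 0 ∨ t i = 1) => ?_) ht)
      rcases h with h | h
      · exact Or.inl (Set.projIcc_of_le_left zero_le_one (by simp only [h]; norm_num))
      · rw [h] at hi
        norm_num at hi
    · refine hb' _ _ (update_mem_boundary (fun (h : t i = 0 ∨ t i = 1) => ?_) ht)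
      rcases h with h | h
      · rw [h] at hi
        norm_num at hi
      · exact Or.inr (Set.projIcc_of_right_le zero_le_one (by simp only [h]; norm_num))

variable [Fintype N]

/-! ### Collars of cubes -/

/-- The collar coordinate of a cube: `0` on the boundary of the concentric cube of half the size
and `1` on the boundary. -/
def collarCoord (t : I^N) : ℝ := 4 * ‖fun i => (t i : ℝ) - 1 / 2‖ - 1

lemma continuous_collarCoord : Continuous (collarCoord (N := N)) := by
  unfold collarCoord
  fun_prop

/-- Rescaling the concentric cube of half the size to the whole cube. -/
def stretch : C(I^N, I^N) where
  toFun t i := Set.projIcc 0 1 zero_le_one (2 * (t i : ℝ) - 1 / 2)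
  continuous_toFun := continuous_pi fun i => continuous_projIcc.comp (by fun_prop)

lemma one_le_collarCoord {t : I^N} (ht : t ∈ Cube.boundary N) : 1 ≤ collarCoord t := by
  obtain ⟨i, hi⟩ := ht
  have h := norm_le_pi_norm (fun i => (t i : ℝ) - 1 / 2) i
  have h' : ‖(t i : ℝ) - 1 / 2‖ = 1 / 2 := by
    rcases hi with hi | hi <;> rw [hi] <;> norm_num
  rw [collarCoord]
  linarith

lemma stretch_mem_boundary {t : I^N} (ht : 0 ≤ collarCoord t) : stretch t ∈ Cube.boundary N := by
  have h : ∃ i, 1 / 4 ≤ ‖(t i : ℝ) - 1 / 2‖ := by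
    by_contra! h
    have := (pi_norm_lt_iff (x := fun i => (t i : ℝ) - 1 / 2) (r := 1 / 4) (by norm_num)).2 h
    rw [collarCoord] at ht
    linarith
  obtain ⟨i, hi⟩ := h
  refine ⟨i, ?_⟩
  rw [Real.norm_eq_abs] at hi
  rcases le_abs.1 hi with h | h
  · exact Or.inr (Set.projIcc_of_right_le zero_le_one (by linarith))
  · exact Or.inl (Set.projIcc_of_le_left zero_le_one (by linarith))

/-- Attaching a collar to a family of maps that are constant on the boundary of the cube. -/
def attach (A : C(S × (I^N), X)) (B : C(S × I, X))
    (h : ∀ s, ∀ y ∈ Cube.boundary N, A (s, y) = B (s, 0)) : C(S × (I^N), X) where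
  toFun q := if collarCoord q.2 ≤ 0 then A (q.1, stretch q.2)
    else B (q.1, Set.projIcc 0 1 zero_le_one (collarCoord q.2))
  continuous_toFun := by
    refine Continuous.if_le (by fun_prop)
      (B.continuous.comp (continuous_fst.prodMk (continuous_projIcc.comp
        (continuous_collarCoord.comp continuous_snd))))
      (continuous_collarCoord.comp continuous_snd) continuous_const fun q hq => ?_
    rw [h _ _ (stretch_mem_boundary hq.ge), hq, Set.projIcc_left]
    rfl

lemma attach_of_mem_boundary (A : C(S × (I^N), X)) (B : C(S × I, X))
    (h : ∀ s, ∀ y ∈ Cube.boundary N, A (s, y) = B (s, 0)) (s : S) {t : I^N}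
    (ht : t ∈ Cube.boundary N) : attach A B h (s, t) = B (s, 1) := by
  have h₁ := one_le_collarCoord ht
  refine (if_neg (by simp only; linarith)).trans ?_
  rw [Set.projIcc_of_right_le _ h₁]
  rfl

lemma attach_of_const (A : C(S × (I^N), X)) (B : C(S × I, X))
    (h : ∀ s, ∀ y ∈ Cube.boundary N, A (s, y) = B (s, 0)) {s : S}
    (hs : ∀ r, B (s, r) = B (s, 0)) (t : I^N) : attach A B h (s, t) = A (s, stretch t) := by
  change ite _ _ _ = _
  split_ifs with ht
  · rfl
  · rw [hs, h _ _ (stretch_mem_boundary (not_le.1 ht).le)]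

/-! ### Transport along paths -/

/-- Transport of a loop along a path, by attaching the path as a collar. -/
def transport (γ : Path x z) (p : GenLoop N X x) : GenLoop N X z :=
  ⟨(attach (S := PUnit.{1}) (p.1.comp ContinuousMap.snd) (γ.toContinuousMap.comp ContinuousMap.snd)
    fun _ y hy => (p.2 y hy).trans γ.source.symm).comp
      ((ContinuousMap.const _ PUnit.unit.{1}).prodMk (ContinuousMap.id _)),
    fun _ ht => (attach_of_mem_boundary (S := PUnit.{1}) (p.1.comp ContinuousMap.snd)
      (γ.toContinuousMap.comp ContinuousMap.snd)
      (fun _ y hy => (p.2 y hy).trans γ.source.symm) PUnit.unit.{1} ht).trans γ.target⟩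

/-- Rescaling of a loop. -/
def shrink (p : GenLoop N X x) : GenLoop N X x :=
  ⟨p.1.comp stretch, fun _ ht =>
    p.2 _ (stretch_mem_boundary (zero_le_one.trans (one_le_collarCoord ht)))⟩

lemma homotopic_transport (γ : Path x z) {p q : GenLoop N X x} (h : Homotopic p q) :
    Homotopic (transport γ p) (transport γ q) := by
  obtain ⟨H⟩ := h
  refine homotopic_of_forall (attach H.toContinuousMap
    (γ.toContinuousMap.comp ContinuousMap.snd)
    fun s y hy => ((H.eq_fst s hy).trans (p.2 y hy)).trans γ.source.symm)
    (fun t => ?_) (fun t => ?_) fun s t ht => ?_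
  · exact congrArg (fun a => ite (collarCoord t ≤ 0) a (γ _)) (H.apply_zero (stretch t))
  · exact congrArg (fun a => ite (collarCoord t ≤ 0) a (γ _)) (H.apply_one (stretch t))
  · exact (attach_of_mem_boundary _ _ _ _ ht).trans γ.target

/-- At time `s` the collar runs along `γ` only from 0 to `s`. -/
lemma homotopicAlong_transport (γ : Path x z) (p : GenLoop N X x) :
    HomotopicAlong γ (shrink p) (transport γ p) := by
  refine ⟨attach (p.1.comp ContinuousMap.snd)
    (γ.toContinuousMap.comp ⟨fun y => y.1 * y.2, by fun_prop⟩)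
    fun s y hy => (p.2 y hy).trans ?_, fun t => ?_, fun t => ?_, fun s t ht => ?_⟩
  · change x = γ (s * 0)
    rw [mul_zero, γ.source]
  · refine attach_of_const _ _ _ (fun r => ?_) t
    change γ (0 * r) = γ (0 * 0)
    rw [zero_mul, zero_mul]
  · exact congrArg (fun r => ite (collarCoord t ≤ 0) (p (stretch t)) (γ r)) (one_mul _)
  · refine (attach_of_mem_boundary _ _ _ _ ht).trans ?_
    change γ (s * 1) = _
    rw [mul_one]

lemma shrink_homotopic (p : GenLoop N X x) : Homotopic (shrink p) p := by
  have key (a b s : I) : (1 - (s : ℝ)) * a + s * b ∈ I :=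
    (convex_Icc (0 : ℝ) 1) a.2 b.2 (by linarith [s.2.2]) s.2.1 (by ring)
  refine homotopic_of_forall (p.1.comp ⟨fun y i =>
    ⟨(1 - (y.1 : ℝ)) * stretch y.2 i + y.1 * y.2 i, key _ _ _⟩, ?_⟩)
    (fun t => ?_) (fun t => ?_) fun s t ht => p.2 _ ?_
  · refine continuous_pi fun i => Continuous.subtype_mk ?_ _
    have h : Continuous fun y : I × (I^N) => stretch y.2 i :=
      (continuous_apply i).comp (stretch.continuous.comp continuous_snd)
    fun_prop
  · refine congrArg p (funext fun i => Subtype.ext ?_)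
    simp
  · refine congrArg p (funext fun i => Subtype.ext ?_)
    simp
  -- `stretch` preserves each face of the cube, so the straight-line homotopy does too.
  · obtain ⟨i, hi⟩ := ht
    refine ⟨i, hi.imp (fun hi => Subtype.ext ?_) fun hi => Subtype.ext ?_⟩
    · have : stretch t i = 0 := Set.projIcc_of_le_left zero_le_one (by rw [hi]; norm_num)
      change (1 - (s : ℝ)) * stretch t i + s * t i = 0
      rw [this, hi]
      simp
    · have : stretch t i = 1 := Set.projIcc_of_right_le zero_le_one (by rw [hi]; norm_num)
      change (1 - (s : ℝ)) * stretch t i + s * t i = 1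
      rw [this, hi]
      simp

/-- Free homotopies determine the transport. At time `s` the collar runs along the rest of `γ`, from
`s` to 1; at the end it is constant, leaving a rescaled `q`. -/
lemma HomotopicAlong.transport_homotopic {γ : Path x z} {p : GenLoop N X x} {q : GenLoop N X z}
    (h : HomotopicAlong γ p q) : Homotopic (transport γ p) q := by
  obtain ⟨H, h₀, h₁, hb⟩ := h
  refine Homotopic.trans (homotopic_of_forall (q := shrink q) (attach H
    (γ.toContinuousMap.comp ⟨fun y => max y.1 y.2, by fun_prop⟩) fun s y hy => (hb s y hy).trans ?_)
    (fun t => ?_) (fun t => ?_) fun s t ht => ?_) (shrink_homotopic q)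
  · change γ s = γ (max s 0)
    rw [max_eq_left unitInterval.nonneg']
  · exact congrArg₂ (fun a r => ite (collarCoord t ≤ 0) a (γ r)) (h₀ (stretch t))
      (max_eq_right unitInterval.nonneg')
  · refine (attach_of_const _ _ _ (fun r => ?_) t).trans (h₁ _)
    change γ (max 1 r) = γ (max 1 0)
    rw [max_eq_left unitInterval.le_one', max_eq_left unitInterval.le_one']
  · refine (attach_of_mem_boundary _ _ _ _ ht).trans ?_
    change γ (max s 1) = _
    rw [max_eq_right unitInterval.le_one', γ.target]

lemma transport_symm_transport (γ : Path x z) (p : GenLoop N X x) :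
    Homotopic (transport γ.symm (transport γ p)) p :=
  (homotopicAlong_transport γ p).symm.transport_homotopic.trans (shrink_homotopic p)

end GenLoop

end

namespace MapPoincare

open GenLoop

variable {X Y Z : Type u} [TopologicalSpace X] [TopologicalSpace Y] [TopologicalSpace Z]

/-! ### Change of base point -/

/-- Transport of homotopy groups along a path, as a map of sets. -/
def homotopyGroupTransport (N : Type) [Fintype N] {x z : X} (γ : Path x z) :
    HomotopyGroup N X x → HomotopyGroup N X z :=
  Quotient.map (transport γ) fun _ _ => homotopic_transport γ

lemma homotopyGroupTransport_symm (N : Type) [Fintype N] {x z : X} (γ : Path x z)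
    (a : HomotopyGroup N X x) :
    homotopyGroupTransport N γ.symm (homotopyGroupTransport N γ a) = a := by
  induction a using Quotient.ind
  exact Quotient.sound (transport_symm_transport γ _)

/-- Collars do not commute with concatenation on the nose. Concatenating the free homotopies to the
transports of both factors gives a free homotopy along `γ`, which identifies the transport of the
product. -/
lemma homotopyGroupTransport_mul (N : Type) [Fintype N] [DecidableEq N] [Nonempty N] {x z : X}
    (γ : Path x z) (a b : HomotopyGroup N X x) :
    homotopyGroupTransport N γ (a * b) =
      homotopyGroupTransport N γ a * homotopyGroupTransport N γ b := by
  induction a using Quotient.ind with | _ p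
  induction b using Quotient.ind with | _ q
  have i : N := Classical.arbitrary N
  have h (p : GenLoop N X x) : @Eq (HomotopyGroup N X x) (Quotient.mk _ (shrink p))
      (Quotient.mk _ p) := Quotient.sound (shrink_homotopic p)
  refine (congrArg (homotopyGroupTransport N γ)
    (congrArg₂ (fun a b : HomotopyGroup N X x => a * b) (h p) (h q))).symm.trans ?_
  refine (congrArg (homotopyGroupTransport N γ) (HomotopyGroup.mul_spec (i := i))).trans
    (Eq.trans ?_ (HomotopyGroup.mul_spec (i := i) (p := transport γ p)
      (q := transport γ q)).symm)
  exact Quotient.sound ((homotopicAlong_transport γ q).transAt i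
    (homotopicAlong_transport γ p)).transport_homotopic

/-- Transport of homotopy groups along a path. -/
def piTransport (k : ℕ) {x z : X} (γ : Path x z) : (π_ (k + 2) X x) ≃* (π_ (k + 2) X z) where
  toFun := homotopyGroupTransport _ γ
  invFun := homotopyGroupTransport _ γ.symm
  left_inv := homotopyGroupTransport_symm _ γ
  right_inv a := by
    have h := homotopyGroupTransport_symm _ γ.symm a
    rwa [Path.symm_symm] at h
  map_mul' := homotopyGroupTransport_mul _ γ

/-- Composing with `f` commutes with attaching a collar already on representatives. -/
lemma piMap_piTransport (k : ℕ) (f : C(X, Y)) {x z : X} (γ : Path x z) (a : π_ (k + 2) X x) :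
    piMap k f z (piTransport k γ a) = piTransport k (γ.map f.continuous) (piMap k f x a) := by
  induction a using Quotient.ind with | _ p
  refine congrArg (Quotient.mk _) (GenLoop.ext _ _ fun t => ?_)
  exact apply_ite f _ _ _

/-- Transport of rational homotopy groups along a path. -/
def ratHomotopyTransport (k : ℕ) {x z : X} (γ : Path x z) :
    RatHomotopy k X x ≃ₗ[ℚ] RatHomotopy k X z :=
  (MulEquiv.toAdditive (piTransport k γ)).toIntLinearEquiv.baseChange ℤ ℚ _ _

lemma rank_ker_ratHomotopyMap [PathConnectedSpace X] (k : ℕ) (f : C(X, Y)) (x z : X) :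
    Module.rank ℚ (LinearMap.ker (ratHomotopyMap k f x)) =
      Module.rank ℚ (LinearMap.ker (ratHomotopyMap k f z)) := by
  obtain ⟨γ⟩ := PathConnectedSpace.joined x z
  refine LinearMap.rank_ker_eq_of_equiv (ratHomotopyTransport k γ)
    (ratHomotopyTransport k (γ.map f.continuous)) fun y => ?_
  induction y using TensorProduct.induction_on with
  | zero => simp only [map_zero]
  | add a b ha hb => simp only [map_add, ha, hb]
  | tmul r a =>
    exact congrArg (fun b => r ⊗ₜ[ℤ] Additive.ofMul b) (piMap_piTransport k f γ a.toMul).symm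

/-! ### Powers -/

/-- The projections of a power. -/
def powProj (n : ℕ) (X : Type u) [TopologicalSpace X] (i : Fin n) : C(Fin n → X, X) :=
  ⟨fun z => z i, continuous_apply i⟩

variable {n : ℕ}

lemma bijective_piMap_powProj (k : ℕ) (z : Fin n → X) :
    Function.Bijective fun (a : π_ (k + 2) (Fin n → X) z) (i : Fin n) =>
      piMap k (powProj n X i) z a := by
  constructor
  · intro a b h
    induction a using Quotient.ind with | _ p
    induction b using Quotient.ind with | _ q
    have H (i : Fin n) := Classical.choice (Quotient.exact (congrFun h i))
    exact Quotient.sound (homotopic_of_forall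
      ⟨fun y i => H i y, continuous_pi fun i => (H i).continuous⟩
      (fun t => funext fun i => (H i).apply_zero t) (fun t => funext fun i => (H i).apply_one t)
      fun s t ht => funext fun i => ((H i).eq_fst s ht).trans (congrFun (p.2 t ht) i))
  · intro a
    refine ⟨Quotient.mk _ ⟨⟨fun t i => (a i).out t,
      continuous_pi fun i => (a i).out.1.continuous⟩,
      fun t ht => funext fun i => (a i).out.2 t ht⟩, funext fun i => ?_⟩
    exact (a i).out_eq

/-- Homotopy groups of a power. -/
def piPowEquiv (k : ℕ) (z : Fin n → X) :
    Additive (π_ (k + 2) (Fin n → X) z) ≃ₗ[ℤ] ∀ i, Additive (π_ (k + 2) X (z i)) :=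
  LinearEquiv.ofBijective
    (LinearMap.pi fun i => (MonoidHom.toAdditive (piMap k (powProj n X i) z)).toIntLinearMap)
    (bijective_piMap_powProj k z)

/-- Rational homotopy groups of a power. -/
def ratHomotopyPowEquiv (k : ℕ) (z : Fin n → X) :
    RatHomotopy k (Fin n → X) z ≃ₗ[ℚ] ∀ i, RatHomotopy k X (z i) :=
  -- Base change commutes with this product because its index set is finite.
  ((piPowEquiv k z).baseChange ℤ ℚ _ _).trans (TensorProduct.piRight ℤ ℚ ℚ _)

lemma piMap_powProj_piMap_power (k : ℕ) (f : C(X, Y)) (z : Fin n → X) (i : Fin n)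
    (a : π_ (k + 2) (Fin n → X) z) :
    piMap k (powProj n Y i) (power n f z) (piMap k (power n f) z a) =
      piMap k f (z i) (piMap k (powProj n X i) z a) := by
  induction a using Quotient.ind
  rfl

lemma ratHomotopyPowEquiv_ratHomotopyMap (k : ℕ) (f : C(X, Y)) (z : Fin n → X)
    (y : RatHomotopy k (Fin n → X) z) :
    ratHomotopyPowEquiv k (power n f z) (ratHomotopyMap k (power n f) z y) =
      LinearMap.pi (fun i => ratHomotopyMap k f (z i) ∘ₗ LinearMap.proj i)
        (ratHomotopyPowEquiv k z y) := by
  induction y using TensorProduct.induction_on with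
  | zero => simp only [map_zero]; rfl
  | add a b ha hb => simp only [map_add, ha, hb]; rfl
  | tmul r a =>
    exact funext fun i => congrArg (fun b => r ⊗ₜ[ℤ] Additive.ofMul b)
      (piMap_powProj_piMap_power k f z i a.toMul)

/-- The kernel of a product of linear maps. -/
def kerPiEquiv {ι : Type*} {V W : ι → Type*} [∀ i, AddCommGroup (V i)] [∀ i, Module ℚ (V i)]
    [∀ i, AddCommGroup (W i)] [∀ i, Module ℚ (W i)] (φ : ∀ i, V i →ₗ[ℚ] W i) :
    LinearMap.ker (LinearMap.pi fun i => φ i ∘ₗ LinearMap.proj i) ≃ₗ[ℚ]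
      ∀ i, LinearMap.ker (φ i) where
  toFun x i := ⟨x.1 i, congrFun x.2 i⟩
  invFun y := ⟨fun i => y i, funext fun i => (y i).2⟩
  map_add' _ _ := rfl
  map_smul' _ _ := rfl
  left_inv _ := rfl
  right_inv _ := rfl

lemma rank_ker_ratHomotopyMap_power [PathConnectedSpace X] (k : ℕ) (f : C(X, Y)) (x : X)
    (z : Fin n → X) : Module.rank ℚ (LinearMap.ker (ratHomotopyMap k (power n f) z)) =
      n * Module.rank ℚ (LinearMap.ker (ratHomotopyMap k f x)) := by
  refine (LinearMap.rank_ker_eq_of_equiv (ratHomotopyPowEquiv k z)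
    (ratHomotopyPowEquiv k (power n f z)) (ratHomotopyPowEquiv_ratHomotopyMap k f z)).trans
    ((kerPiEquiv fun i => ratHomotopyMap k f (z i)).rank_eq.trans ?_)
  rw [rank_pi]
  simp only [rank_ker_ratHomotopyMap k f _ x]
  simp

variable [PathConnectedSpace X] {f : C(X, Y)} {x : X}

lemma finiteTotalDim_ker_ratHomotopyMap_power
    (hf : FiniteTotalDim fun k => LinearMap.ker (ratHomotopyMap k f x)) (z : Fin n → X) :
    FiniteTotalDim fun k => LinearMap.ker (ratHomotopyMap k (power n f) z) := by
  refine ⟨fun k => ?_, hf.2.subset fun k hk => ?_⟩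
  · refine Module.rank_lt_aleph0_iff.1 ?_
    rw [rank_ker_ratHomotopyMap_power k f x z]
    exact Cardinal.mul_lt_aleph0 (Cardinal.natCast_lt_aleph0) (Module.rank_lt_aleph0_iff.2 (hf.1 k))
  · have h : 0 < Module.rank ℚ (LinearMap.ker (ratHomotopyMap k (power n f) z)) :=
      rank_pos_iff_nontrivial.2 hk
    rw [rank_ker_ratHomotopyMap_power k f x z] at h
    exact rank_pos_iff_nontrivial.1 (pos_of_ne_zero (right_ne_zero_of_mul h.ne'))

lemma homotopicalPoincare_power
    (hf : FiniteTotalDim fun k => LinearMap.ker (ratHomotopyMap k f x)) (z : Fin n → X) :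
    homotopicalPoincare (power n f) z = n • homotopicalPoincare f x := by
  refine Polynomial.ext fun k => ?_
  rw [Polynomial.coeff_smul, coeff_homotopicalPoincare hf,
    coeff_homotopicalPoincare (finiteTotalDim_ker_ratHomotopyMap_power hf z)]
  split_ifs
  · rw [Module.finrank, rank_ker_ratHomotopyMap_power _ f x z, map_mul, Cardinal.toNat_natCast]
    rfl
  · rfl

end MapPoincare

end

theorem mainTheorem3 {X Y : Type u} [TopologicalSpace X] [TopologicalSpace Y]
    [SimplyConnectedSpace X] [SimplyConnectedSpace Y] (f : C(X, Y)) (x : X)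
    (hf : MapPoincare.IsRationallyEllipticKer f x) (hX : MapPoincare.FiniteHomologyRank X)
    (n : ℕ) (z : Fin n → X) :
    MapPoincare.IsRationallyEllipticKer (MapPoincare.power n f) z ∧
    (∀ t : ℝ,
      Polynomial.aeval t (MapPoincare.homotopicalPoincare (MapPoincare.power n f) z) =
        n * Polynomial.aeval t (MapPoincare.homotopicalPoincare f x)) ∧
    (∀ t : ℝ, 0 ≤ t →
      (Polynomial.aeval t (MapPoincare.homologicalPoincare f)) ^ n ≤
        Polynomial.aeval t (MapPoincare.homologicalPoincare (MapPoincare.power n f))) := by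
  -- Kernels for `f^n` involve whole homology groups of the other factors, so their finiteness is
  -- drawn from that of `H_*(X^n)`.
  refine ⟨⟨(hX.pow n).ker _, MapPoincare.finiteTotalDim_ker_ratHomotopyMap_power hf.2 z⟩,
    fun t => ?_, fun t ht => MapPoincare.aeval_homologicalPoincare_pow_le hX f n ht⟩
  rw [MapPoincare.homotopicalPoincare_power hf.2 z, map_nsmul, nsmul_eq_mul]
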